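/- Let $K$ be a field of characteristic $0$ with algebraic closure $\bar K$, and let $R=K[x_1,\ldots,x_n]$ with variables ordered $x_1<\cdots<x_n$ and the lexicographic term order. **Notions.** The leading variable of $P\in R\setminus K$ is the greatest variable occurring in $P$; the initial $\mathrm{ini}(P)$ is the leading coefficient of $P$ with respect to it. A triangular set is a list $[T_1,\ldots,T_r]$ of nonconstant polynomials with strictly increasing leading variables (the empty list is admitted), or a trivial list $[c]$ with $c\in K\setminus\{0\}$. With $J$ the product of the initials, $\mathrm{sat}(T)=\{P: PJ^k\in\langle T\rangle\text{ for some }k\ge 0\}$; in particular $\mathrm{sat}([c])=\langle 1\rangle$ and $\mathrm{sat}([\,])=\langle 0\rangle$. $T$ is regular if, for every $i$, $\mathrm{ini}(T_i)$ is neither zero nor a zero divisor in $R/\mathrm{sat}([T_1,\ldots,T_{i-1}])$ (for $T=[c]$ put $\mathrm{ini}(c)=c$, so $[c]$ is regular). The W-characteristic set of an ideal is formed by the constants and, for each $i$, the smallest polynomial with leading variable $x_i$ (if any) in its reduced Gröbner basis, in increasing order of leading variables. A strong regular characteristic pair (src pair) is a pair $(G,C)$ where $G$ is a reduced Gröbner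 basis, $C$ is the W-characteristic set of $\langle G\rangle$, $\mathrm{sat}(C)=\langle G\rangle$, and $C$ is regular. It is an src divisor of an ideal $I$ if moreover $I:\langle G\rangle\neq I$. Zero sets $Z(\cdot)$ are taken in $\bar K^n$. **Algorithms.** * $\mathrm{srcPair}(I)$: while the W-characteristic set $C$ of $I$ has $\mathrm{sat}(C)\neq I$, replace $I$ by $\mathrm{sat}(C)$; then return the reduced Gröbner basis and the W-characteristic set of $I$. * $\mathrm{srcDiv}(I)$, for $I\ne\langle1\rangle$: search from the node $N=I$. At a node $N$ compute $(G,C)=\mathrm{srcPair}(N)$. If $I:\langle G\rangle\ne I$, return $(G,C)$. Otherwise let $C^*$ be the W-characteristic set of $N$. If $\mathrm{sat}(C^*)=N$, the search fails at $N$. If not, choose any $F\in\mathrm{sat}(C^*)\setminus N$ and any $H_1,\ldots,H_t\in R\setminus N$ such that $H_1\cdots H_t$ and $F\prod_{P\in C^*}\mathrm{ini}(P)$ have the same zeros in $\bar K^n$, and search from the nodes $\langle N\cup\{H_i\}\rangle$, in any order, until a pair is returned; if the search fails at all of them, it fails at $N$. * $\mathrm{srcDec}(F)$, for a finite $F\subset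 R$: start with $\Psi=\emptyset$ and $I=\langle F\rangle$; while $I\ne\langle 1\rangle$, compute $(G,C)=\mathrm{srcDiv}(I)$, adjoin $(G,C)$ to $\Psi$, and replace $I$ by $I:\langle G\rangle$; finally return $\Psi$. **Theorem.** 1. For every ideal $I$, $\mathrm{srcPair}(I)$ terminates, and it returns an src pair $(G,C)$ with $I\subseteq\langle G\rangle$. 2. Whatever choices are made, the search in $\mathrm{srcDiv}$ is never stuck (whenever $\mathrm{sat}(C^*)\neq N$ there is an admissible choice of $F$ and the $H_i$) and terminates (there is no infinite chain of successive nodes). For $I\ne\langle1\rangle$ it never fails, and it returns an src divisor $(G,C)$ of $I$ with $I\subseteq\langle G\rangle$. 3. Whatever choices are made, $\mathrm{srcDec}$ is never stuck and terminates. Hence it returns some $\Psi$ for every finite set $F\subset R$, and every $\Psi=\{(G_1,C_1),\ldots,(G_e,C_e)\}$ that it can return is a finite set of src pairs with $G_i\ne\{1\}$ and satisfies $$\sqrt{\langle F\rangle}=\bigcap_{i=1}^e\sqrt{\mathrm{sat}(C_i)}=\bigcap_{i=1}^e\sqrt{\langle G_i\rangle},\qquad Z(F)=\bigcup_{i=1}^e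 Z(G_i)=\bigcup_{i=1}^e Z(\mathrm{sat}(C_i)).$$ If $\langle F\rangle=\langle1\rangle$, then $\Psi=\emptyset$ (empty intersections being $R$); if $F$ contains a nonzero polynomial, then all $C_i$ are nonempty. 4. For every finite $F\subset R$ and every finite set of pairs $(G_i,C_i)$, where $G_i\subset R$ is a finite set and $C_i$ is a finite list in $R$, the displayed ideal relations hold if and only if the displayed zero relations hold. -/

import Mathlib

open MvPolynomial

namespace SrcDec

variable {K : Type*} [Field K] {n : ℕ}

/-- The lexicographic term order on the monomials in `x_0, …, x_{n-1}` with
`x_0 < x_1 < ⋯ < x_{n-1}`. (Mathlib's `MonomialOrder.lex` makes the variable with the smallest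
index the greatest one, hence the order dual.) -/
noncomputable def lexOrder (n : ℕ) : MonomialOrder (Fin n) where
  syn := Lex ((Fin n)ᵒᵈ →₀ ℕ)
  toSyn := (Finsupp.domCongr OrderDual.toDual).trans
    { toEquiv := toLex
      map_add' := toLex_add }
  toSyn_monotone := by
    intro a b h
    refine Finsupp.toLex_monotone ?_
    intro i
    exact h (OrderDual.ofDual i)

/-- Terms are compared by the exponent of the greatest variable in which they differ. -/
theorem lexOrder_lt_iff (a b : Fin n →₀ ℕ) :
    (lexOrder n).toSyn a < (lexOrder n).toSyn b ↔ ∃ i, (∀ j, i < j → a j = b j) ∧ a i < b i := by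
  have h : (lexOrder n).toSyn a < (lexOrder n).toSyn b ↔
      Finsupp.Lex (fun i j : (Fin n)ᵒᵈ => i < j) (fun p q : ℕ => p < q)
        (Finsupp.domCongr OrderDual.toDual a) (Finsupp.domCongr OrderDual.toDual b) := Iff.rfl
  rw [h]
  exact Iff.rfl

/-- The leading variable: the (index of the) greatest variable that occurs in `F`;
it is `⊥` exactly when `F` is a constant. -/
noncomputable def lv (F : MvPolynomial (Fin n) K) : WithBot (Fin n) :=
  F.vars.max

/-- The coefficient of `F` with respect to the highest power of `x_i` that occurs in `F`. -/
noncomputable def coeffTop (i : Fin n) (F : MvPolynomial (Fin n) K) : MvPolynomial (Fin n) K :=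
  ∑ m ∈ F.support with m i = F.degreeOf i, monomial (m.erase i) (F.coeff m)

/-- The initial of `F`: the leading coefficient of `F` with respect to its leading variable
(a constant is its own initial). -/
noncomputable def ini (F : MvPolynomial (Fin n) K) : MvPolynomial (Fin n) K :=
  WithBot.recBotCoe F (fun i => coeffTop i F) (lv F)

/-- The product of the initials of the polynomials in `T`. -/
noncomputable def iniProd (T : List (MvPolynomial (Fin n) K)) : MvPolynomial (Fin n) K :=
  (T.map ini).prod

/-- The ideal generated by the polynomials in `T`. -/
noncomputable def listIdeal (T : List (MvPolynomial (Fin n) K)) : Ideal (MvPolynomial (Fin n) K) :=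
  Ideal.span {P | P ∈ T}

/-- The saturated ideal `sat(T) = {P | P J ^ k ∈ ⟨T⟩ for some k}`, where `J` is the product of the
initials of the polynomials in `T`. -/
noncomputable def sat (T : List (MvPolynomial (Fin n) K)) : Ideal (MvPolynomial (Fin n) K) where
  carrier := {P | ∃ k : ℕ, P * iniProd T ^ k ∈ listIdeal T}
  add_mem' := by
    rintro P Q ⟨a, ha⟩ ⟨b, hb⟩
    refine ⟨a + b, ?_⟩
    have h : (P + Q) * iniProd T ^ (a + b)
        = iniProd T ^ b * (P * iniProd T ^ a) + iniProd T ^ a * (Q * iniProd T ^ b) := by ring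
    rw [h]
    exact Ideal.add_mem _ (Ideal.mul_mem_left _ _ ha) (Ideal.mul_mem_left _ _ hb)
  zero_mem' := ⟨0, by simp⟩
  smul_mem' := by
    rintro c P ⟨a, ha⟩
    refine ⟨a, ?_⟩
    rw [smul_eq_mul, mul_assoc]
    exact Ideal.mul_mem_left _ _ ha

/-- Triangular sets: either nonconstant polynomials with strictly increasing leading variables,
or a trivial one `[c]` with a nonzero constant `c`. (The empty list is admitted; it is the
W-characteristic set of the zero ideal.) -/
def IsTriangularSet (T : List (MvPolynomial (Fin n) K)) : Prop :=
  ((∀ P ∈ T, lv P ≠ ⊥) ∧ T.Pairwise (fun P Q => lv P < lv Q)) ∨ ∃ c : K, c ≠ 0 ∧ T = [C c]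

/-- Regular sets (regular chains): triangular sets `[T_1, …, T_r]` such that the initial of `T_i` is
neither zero nor a zero divisor modulo `sat([T_1, …, T_{i-1}])`, for all `i`. -/
def IsRegularSet (T : List (MvPolynomial (Fin n) K)) : Prop :=
  IsTriangularSet T ∧ ∀ i : Fin T.length,
    Ideal.Quotient.mk (sat (T.take i)) (ini (T.get i)) ≠ 0 ∧
    Ideal.Quotient.mk (sat (T.take i)) (ini (T.get i)) ∈
      nonZeroDivisors (MvPolynomial (Fin n) K ⧸ sat (T.take i))

/-- `G` is a (lex) Gröbner basis of the ideal `I`. -/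
def IsGB (G : Finset (MvPolynomial (Fin n) K)) (I : Ideal (MvPolynomial (Fin n) K)) : Prop :=
  (G : Set (MvPolynomial (Fin n) K)) ⊆ I ∧
    Ideal.span ((lexOrder n).leadingTerm '' (G : Set (MvPolynomial (Fin n) K)))
      = Ideal.span ((lexOrder n).leadingTerm '' (I : Set (MvPolynomial (Fin n) K)))

/-- `G` is the reduced (lex) Gröbner basis of the ideal `I`: its elements are monic and no term of
one of them is divisible by the leading term of another one. -/
def IsReducedGB (G : Finset (MvPolynomial (Fin n) K)) (I : Ideal (MvPolynomial (Fin n) K)) :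
    Prop :=
  IsGB G I ∧ (∀ P ∈ G, (lexOrder n).Monic P) ∧
    ∀ P ∈ G, ∀ Q ∈ G, Q ≠ P → ∀ m ∈ P.support, ¬ (lexOrder n).degree Q ≤ m

/-- `T` is the W-characteristic set of the ideal `I`: it consists of the smallest polynomial of
each leading variable (and of the constants) in the reduced Gröbner basis of `I`, listed with
increasing leading variables. -/
def IsWCharSet (T : List (MvPolynomial (Fin n) K)) (I : Ideal (MvPolynomial (Fin n) K)) : Prop :=
  ∃ G : Finset (MvPolynomial (Fin n) K), IsReducedGB G I ∧
    T.Pairwise (fun P Q => lv P < lv Q) ∧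
    ∀ P, P ∈ T ↔ P ∈ G ∧ ∀ Q ∈ G, lv Q = lv P →
      (lexOrder n).toSyn ((lexOrder n).degree P) ≤ (lexOrder n).toSyn ((lexOrder n).degree Q)

/-- Pairs `(G, C)` of polynomial sets, the second one ordered. -/
abbrev PolyPair (n : ℕ) (K : Type*) [Field K] : Type _ :=
  Finset (MvPolynomial (Fin n) K) × List (MvPolynomial (Fin n) K)

/-- The ideal `⟨G⟩` of a pair `(G, C)`. -/
noncomputable def PolyPair.ideal (p : PolyPair n K) : Ideal (MvPolynomial (Fin n) K) :=
  Ideal.span (p.1 : Set (MvPolynomial (Fin n) K))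

/-- `(G, C)` is a characteristic pair: `G` is a reduced lex Gröbner basis and `C` is the
W-characteristic set of `⟨G⟩`. -/
def IsCharPair (p : PolyPair n K) : Prop :=
  IsReducedGB p.1 p.ideal ∧ IsWCharSet p.2 p.ideal

/-- Strong regular characteristic (src) pairs. -/
def IsSrcPair (p : PolyPair n K) : Prop :=
  IsCharPair p ∧ sat p.2 = p.ideal ∧ IsRegularSet p.2

/-- The ideal quotient `I : J`. -/
noncomputable def quot (I J : Ideal (MvPolynomial (Fin n) K)) : Ideal (MvPolynomial (Fin n) K) :=
  I.colon (J : Set (MvPolynomial (Fin n) K))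

/-- `J` divides `I` if `I : J ≠ I`. -/
def Divides (J I : Ideal (MvPolynomial (Fin n) K)) : Prop :=
  quot I J ≠ I

/-- `(G, C)` is an src divisor of `I`: an src pair whose ideal `⟨G⟩ = sat(C)` divides `I`. -/
def IsSrcDivisor (p : PolyPair n K) (I : Ideal (MvPolynomial (Fin n) K)) : Prop :=
  IsSrcPair p ∧ Divides p.ideal I

/-- The procedure `srcPair`: `SrcPair I (G, C)` says that it returns `(G, C)` on input `I`.
As long as `sat(C) ≠ I` for the W-characteristic set `C` of `I`, the ideal `I` is replaced
by `sat(C)`; then the reduced Gröbner basis and the W-characteristic set of `I` are returned. -/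
inductive SrcPair : Ideal (MvPolynomial (Fin n) K) → PolyPair n K → Prop
  | done {I : Ideal (MvPolynomial (Fin n) K)} {G : Finset (MvPolynomial (Fin n) K)}
      {T : List (MvPolynomial (Fin n) K)} :
      IsReducedGB G I → IsWCharSet T I → sat T = I → SrcPair I (G, T)
  | saturate {I : Ideal (MvPolynomial (Fin n) K)} {T : List (MvPolynomial (Fin n) K)}
      {p : PolyPair n K} :
      IsWCharSet T I → sat T ≠ I → SrcPair (sat T) p → SrcPair I p

/-- An admissible choice of the polynomials `H_1, …, H_t` by which the procedure `srcDiv` branches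
at an ideal `N` with W-characteristic set `T`: there is an `F` in `sat(T)` but not in `N`, no `H_i`
is in `N`, and over the algebraic closure `H_1 ⋯ H_t = 0` if and only if `F J = 0`, where `J` is the
product of the initials of `T`. -/
def IsBranching (N : Ideal (MvPolynomial (Fin n) K)) (T Hs : List (MvPolynomial (Fin n) K)) :
    Prop :=
  ∃ F ∈ sat T, F ∉ N ∧ (∀ H ∈ Hs, H ∉ N) ∧
    ∀ x : Fin n → AlgebraicClosure K, aeval x Hs.prod = 0 ↔ aeval x (F * iniProd T) = 0

/-- The nondeterministic search in the procedure `srcDiv` for an src divisor of `I`.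
`SrcSearch I N o` says that the search below the node `N` can end with outcome `o`: a pair found
(`some p`) or a failure (`none`). If the pair `srcPair N` divides `I`, it is the outcome. Otherwise
the search fails at `N` if `N = sat(T)` for the W-characteristic set `T` of `N` (in particular if
`N = ⟨1⟩`); if `sat(T) ≠ N`, polynomials `H_1, …, H_t` are chosen and the
search continues with the ideals `⟨N ∪ {H_i}⟩`, in any order; it fails at `N` if it fails at
all of them. -/
inductive SrcSearch (I : Ideal (MvPolynomial (Fin n) K)) :
    Ideal (MvPolynomial (Fin n) K) → Option (PolyPair n K) → Prop
  | hit {N : Ideal (MvPolynomial (Fin n) K)} {p : PolyPair n K} :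
      SrcPair N p → Divides p.ideal I → SrcSearch I N (some p)
  | leaf {N : Ideal (MvPolynomial (Fin n) K)} {p : PolyPair n K}
      {T : List (MvPolynomial (Fin n) K)} :
      SrcPair N p → ¬ Divides p.ideal I → IsWCharSet T N → sat T = N → SrcSearch I N none
  | branchHit {N : Ideal (MvPolynomial (Fin n) K)} {p q : PolyPair n K}
      {T Hs : List (MvPolynomial (Fin n) K)} {H : MvPolynomial (Fin n) K} :
      SrcPair N p → ¬ Divides p.ideal I → IsWCharSet T N → sat T ≠ N → IsBranching N T Hs →
      H ∈ Hs → SrcSearch I (N ⊔ Ideal.span {H}) (some q) → SrcSearch I N (some q)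
  | branchFail {N : Ideal (MvPolynomial (Fin n) K)} {p : PolyPair n K}
      {T Hs : List (MvPolynomial (Fin n) K)} :
      SrcPair N p → ¬ Divides p.ideal I → IsWCharSet T N → sat T ≠ N → IsBranching N T Hs →
      (∀ H ∈ Hs, SrcSearch I (N ⊔ Ideal.span {H}) none) → SrcSearch I N none

/-- `SearchCall N' N`: the search at the node `N` can call itself at the node `N'`. -/
def SearchCall (N' N : Ideal (MvPolynomial (Fin n) K)) : Prop :=
  ∃ T Hs : List (MvPolynomial (Fin n) K), IsWCharSet T N ∧ sat T ≠ N ∧ IsBranching N T Hs ∧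
    ∃ H ∈ Hs, N' = N ⊔ Ideal.span {H}

/-- The procedure `srcDiv` can return the pair `p` on input `I`. -/
def SrcDiv (I : Ideal (MvPolynomial (Fin n) K)) (p : PolyPair n K) : Prop :=
  SrcSearch I I (some p)

/-- One pass through the loop of the algorithm `srcDec`, on states `(I, Ψ)`: while `I ≠ ⟨1⟩`, a pair
`(G, C)` returned by `srcDiv` on `I` is adjoined to `Ψ`, and `I` is replaced by `I : ⟨G⟩`. -/
inductive SrcDecStep :
    Ideal (MvPolynomial (Fin n) K) × Set (PolyPair n K) →
    Ideal (MvPolynomial (Fin n) K) × Set (PolyPair n K) → Prop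
  | mk {I : Ideal (MvPolynomial (Fin n) K)} {Ψ : Set (PolyPair n K)} {p : PolyPair n K} :
      I ≠ ⊤ → SrcDiv I p → SrcDecStep (I, Ψ) (quot I p.ideal, insert p Ψ)

/-- The algorithm `srcDec` can return `Ψ` on input `F`: it starts in the state `(⟨F⟩, ∅)`
and stops in a state `(⟨1⟩, Ψ)`. -/
def SrcDecReturns (F : Finset (MvPolynomial (Fin n) K)) (Ψ : Set (PolyPair n K)) : Prop :=
  Relation.ReflTransGen SrcDecStep
    (Ideal.span (F : Set (MvPolynomial (Fin n) K)), ∅) (⊤, Ψ)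

/-- The common zeros of a set of polynomials over the algebraic closure of `K`. -/
def zeros (S : Set (MvPolynomial (Fin n) K)) : Set (Fin n → AlgebraicClosure K) :=
  {x | ∀ P ∈ S, aeval x P = 0}

/-- `√⟨F⟩ = ⋂ √sat(C) = ⋂ √⟨G⟩`, over all pairs `(G, C)` in `Ψ`. -/
def IdealDecomposition (F : Finset (MvPolynomial (Fin n) K)) (Ψ : Set (PolyPair n K)) : Prop :=
  (Ideal.span (F : Set (MvPolynomial (Fin n) K))).radical = ⨅ p ∈ Ψ, (sat p.2).radical ∧
  (Ideal.span (F : Set (MvPolynomial (Fin n) K))).radical = ⨅ p ∈ Ψ, p.ideal.radical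

/-- `Z(F) = ⋃ Z(G) = ⋃ Z(sat(C))`, over all pairs `(G, C)` in `Ψ`. -/
def ZeroDecomposition (F : Finset (MvPolynomial (Fin n) K)) (Ψ : Set (PolyPair n K)) : Prop :=
  zeros (F : Set (MvPolynomial (Fin n) K))
    = ⋃ p ∈ Ψ, zeros (p.1 : Set (MvPolynomial (Fin n) K)) ∧
  zeros (F : Set (MvPolynomial (Fin n) K))
    = ⋃ p ∈ Ψ, zeros (sat p.2 : Set (MvPolynomial (Fin n) K))

end SrcDec

open SrcDec

/-! Termination is Noetherian throughout: saturating, adding a polynomial `H` outside the node, and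
passing to the quotient by a divisor each strictly enlarge the ideal.

For `srcPair`, pseudo-reduction by the W-characteristic set `C` gives `I ≤ sat C`
(`IsWCharSet.le_sat`). The same reduction, restricted to the variables below a leading variable,
shows that `sat C = I` already forces `C` to be regular (`IsWCharSet.isRegularSet`): modulo the
elements of `C` in the lower variables, the problem splits into coefficients with respect to the
higher variables.

For `srcDiv`, the search is guided by an associated prime `𝔭 = I : a` of `I`, which the algorithm
never sees. A node contained in `𝔭` cannot fail (`SrcSearch.not_le_of_eq_colon`). At a leaf, `N ≤ I
: a` puts `a` in `I : N = I`, which is absurd. At a branching, `F * J ^ k ∈ N ≤ 𝔭` gives `F * J ∈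
𝔭`; by the Nullstellensatz a power of `H_1 ⋯ H_t` is a multiple of `F * J`, so some `H_i` lies in
`𝔭` and its child is again contained in `𝔭`. The root `I` is contained in `I : a`. An admissible
branching always exists, namely `F` followed by the initials of `C` (`exists_isBranching`).

For `srcDec`, the loop invariant rests on `√I = √(I : J) ∩ √J` for `I ≤ J`
(`radical_eq_radical_quot_inf`). Ideal relations and zero relations are exchanged by the
Nullstellensatz and the primality of the kernel of evaluation at a point. -/

namespace SrcDec

variable {K : Type*} [Field K] {n : ℕ}

/-! ### Reduced Gröbner bases and W-characteristic sets: existence and uniqueness. -/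

section GroebnerBases

section Groebner

variable {σ : Type*} (o : MonomialOrder σ)

/-- A leading term that lies in the ideal generated by the leading terms of `S` is divisible by one
of them. -/
theorem exists_degree_le_of_leadingTerm_mem_span {S : Set (MvPolynomial σ K)}
    {P : MvPolynomial σ K} (hP : P ≠ 0)
    (h : o.leadingTerm P ∈ Ideal.span (o.leadingTerm '' S)) :
    ∃ Q ∈ S, Q ≠ 0 ∧ o.degree Q ≤ o.degree P := by
  classical
  -- Over a field the coefficients of the leading terms can be dropped, so the membership criterion
  -- for monomial ideals applies.
  have hle : Ideal.span (o.leadingTerm '' S) ≤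
      Ideal.span ((fun s => monomial s (1 : K)) '' (o.degree '' (S \ {0}))) := by
    rw [Ideal.span_le]
    rintro _ ⟨Q, hQ, rfl⟩
    by_cases hQ0 : Q = 0
    · simp [hQ0]
    rw [← o.C_mul_leadingCoeff_monomial_degree]
    exact Ideal.mul_mem_left _ _ (Ideal.subset_span ⟨_, ⟨Q, ⟨hQ, hQ0⟩, rfl⟩, rfl⟩)
  have h' := mem_ideal_span_monomial_image.1 (hle h) (o.degree P) (by
    rw [mem_support_iff, MonomialOrder.leadingTerm, coeff_monomial, if_pos rfl]
    exact o.leadingCoeff_ne_zero_iff.2 hP)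
  obtain ⟨_, ⟨Q, ⟨hQ, hQ0⟩, rfl⟩, hd⟩ := h'
  exact ⟨Q, hQ, hQ0, hd⟩

theorem leadingTerm_mem_span_of_degree_le {S : Set (MvPolynomial σ K)} {P Q : MvPolynomial σ K}
    (hQ : Q ∈ S) (hQ0 : Q ≠ 0) (h : o.degree Q ≤ o.degree P) :
    o.leadingTerm P ∈ Ideal.span (o.leadingTerm '' S) := by
  have hc : o.leadingCoeff Q ≠ 0 := o.leadingCoeff_ne_zero_iff.2 hQ0
  have : o.leadingTerm P
      = monomial (o.degree P - o.degree Q) (o.leadingCoeff P / o.leadingCoeff Q)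
        * o.leadingTerm Q := by
    rw [MonomialOrder.leadingTerm, MonomialOrder.leadingTerm, monomial_mul,
      tsub_add_cancel_of_le h, div_mul_cancel₀ _ hc]
  rw [this]
  exact Ideal.mul_mem_left _ _ (Ideal.subset_span ⟨Q, hQ, rfl⟩)

end Groebner

variable {I : Ideal (MvPolynomial (Fin n) K)} {G : Finset (MvPolynomial (Fin n) K)}
  {T : List (MvPolynomial (Fin n) K)}

theorem IsGB.exists_degree_le (h : IsGB G I) {P : MvPolynomial (Fin n) K} (hP : P ∈ I)
    (hP0 : P ≠ 0) : ∃ Q ∈ G, Q ≠ 0 ∧ (lexOrder n).degree Q ≤ (lexOrder n).degree P := by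
  refine exists_degree_le_of_leadingTerm_mem_span (lexOrder n) (S := G) hP0 ?_
  rw [h.2]
  exact Ideal.subset_span ⟨P, hP, rfl⟩

theorem IsReducedGB.degree_le (h : IsReducedGB G I) {P Q : MvPolynomial (Fin n) K}
    (hP : P ∈ G) (hQ : Q ∈ G) (hPQ : (lexOrder n).degree Q ≤ (lexOrder n).degree P) : Q = P := by
  by_contra hne
  exact h.2.2 P hP Q hQ hne _ ((lexOrder n).degree_mem_support (h.2.1 P hP).ne_zero) hPQ

theorem IsReducedGB.span_eq (h : IsReducedGB G I) :
    Ideal.span (G : Set (MvPolynomial (Fin n) K)) = I := by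
  refine le_antisymm (Ideal.span_le.2 h.1.1) fun P hP => ?_
  obtain ⟨g, r, hg, -, hr⟩ := (lexOrder n).div_set (B := (G : Set (MvPolynomial (Fin n) K)))
    (fun b hb => by rw [(h.2.1 b hb).leadingCoeff_eq_one]; exact isUnit_one) P
  have hmem : Finsupp.linearCombination (MvPolynomial (Fin n) K)
      (fun b : (G : Set (MvPolynomial (Fin n) K)) => (b : MvPolynomial (Fin n) K)) g
        ∈ Ideal.span (G : Set (MvPolynomial (Fin n) K)) := by
    rw [Finsupp.linearCombination_apply]
    exact Ideal.sum_mem _ fun b _ => Ideal.mul_mem_left _ _ (Ideal.subset_span b.2)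
  have hr0 : r = 0 := by
    by_contra hr0
    have hrI : r ∈ I := by
      rw [eq_sub_of_add_eq' hg.symm]
      exact I.sub_mem hP (Ideal.span_le.2 h.1.1 hmem)
    obtain ⟨Q, hQ, -, hd⟩ := h.1.exists_degree_le hrI hr0
    exact hr _ ((lexOrder n).degree_mem_support hr0) Q hQ hd
  rw [hg, hr0, add_zero]
  exact hmem

/-- Each `P` in `G` has a partner `Q` in `G'` of the same degree. If they differed, the leading
exponent of `P - Q` would be that of a non-leading term of `P` or `Q`, yet divisible by a leading
term of either basis, against reducedness. -/
theorem IsReducedGB.subset {G' : Finset (MvPolynomial (Fin n) K)} (h : IsReducedGB G I)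
    (h' : IsReducedGB G' I) : G ⊆ G' := by
  intro P hP
  have hP0 := (h.2.1 P hP).ne_zero
  obtain ⟨Q, hQ, hQ0, hQP⟩ := h'.1.exists_degree_le (h.1.1 hP) hP0
  obtain ⟨P', hP', -, hPQ⟩ := h.1.exists_degree_le (h'.1.1 hQ) hQ0
  obtain rfl := h.degree_le hP hP' (hPQ.trans hQP)
  have hdeg : (lexOrder n).degree Q = (lexOrder n).degree P' := le_antisymm hQP hPQ
  suffices P' = Q by rwa [this]
  by_contra hne
  have hD0 : P' - Q ≠ 0 := sub_ne_zero.2 hne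
  have hDI : P' - Q ∈ I := I.sub_mem (h.1.1 hP) (h'.1.1 hQ)
  set m := (lexOrder n).degree (P' - Q) with hm
  have hms : m ∈ (P' - Q).support := (lexOrder n).degree_mem_support hD0
  have hmne : m ≠ (lexOrder n).degree P' := by
    intro hmP
    rw [mem_support_iff, coeff_sub, hmP, (h.2.1 P' hP).coeff_degree, ← hdeg,
      (h'.2.1 Q hQ).coeff_degree, sub_self] at hms
    exact hms rfl
  have hlt : ∀ R : MvPolynomial (Fin n) K, m ∈ R.support →
      (lexOrder n).degree R = (lexOrder n).degree P' →
      ¬ (lexOrder n).degree R ≤ m := by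
    intro R hR hRP hle
    refine hmne ((lexOrder n).toSyn.injective (le_antisymm ?_ ?_))
    · rw [← hRP]; exact (lexOrder n).le_degree hR
    · rw [← hRP]; exact (lexOrder n).toSyn_monotone hle
  have hor : m ∈ P'.support ∨ m ∈ Q.support := by
    by_contra hcon
    push Not at hcon
    rw [notMem_support_iff, notMem_support_iff] at hcon
    rw [mem_support_iff, coeff_sub, hcon.1, hcon.2, sub_zero] at hms
    exact hms rfl
  rcases hor with hs | hs
  · obtain ⟨R, hR, -, hd⟩ := h.1.exists_degree_le hDI hD0
    by_cases hRP : R = P'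
    · subst hRP; exact hlt _ hs rfl hd
    · exact h.2.2 P' hP R hR hRP m hs hd
  · obtain ⟨R, hR, -, hd⟩ := h'.1.exists_degree_le hDI hD0
    by_cases hRP : R = Q
    · subst hRP; exact hlt _ hs hdeg hd
    · exact h'.2.2 Q hQ R hR hRP m hs hd

theorem IsReducedGB.eq {G' : Finset (MvPolynomial (Fin n) K)} (h : IsReducedGB G I)
    (h' : IsReducedGB G' I) : G = G' :=
  (h.subset h').antisymm (h'.subset h)

/-- An ideal contains a monic polynomial of every degree `μ` of its elements, all of whose other
terms are not leading terms of elements of the ideal. -/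
theorem exists_monic_reduced {P₀ : MvPolynomial (Fin n) K} (hP₀ : P₀ ∈ I) (h0 : P₀ ≠ 0) :
    ∃ P ∈ I, (lexOrder n).Monic P ∧ (lexOrder n).degree P = (lexOrder n).degree P₀ ∧
      ∀ m ∈ P.support, m ≠ (lexOrder n).degree P → ∀ Q ∈ I, Q ≠ 0 → ¬ (lexOrder n).degree Q ≤ m := by
  classical
  set μ := (lexOrder n).degree P₀ with hμ
  -- The polynomial sought is `x ^ μ` minus its normal form `r` modulo all nonzero elements of `I`.
  -- Since `P₀` is among the divisors, `μ` does not occur in `r`, and all other terms come from `r`.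
  obtain ⟨g, r, hg, hgd, hr⟩ := (lexOrder n).div_set
    (B := {Q : MvPolynomial (Fin n) K | Q ∈ I ∧ Q ≠ 0})
    (fun b hb => ((lexOrder n).leadingCoeff_ne_zero_iff.2 hb.2).isUnit) (monomial μ 1)
  set l := Finsupp.linearCombination (MvPolynomial (Fin n) K)
    (fun b : {Q : MvPolynomial (Fin n) K | Q ∈ I ∧ Q ≠ 0} => (b : MvPolynomial (Fin n) K)) g with hl
  have hlI : l ∈ I := by
    rw [hl, Finsupp.linearCombination_apply]
    exact Ideal.sum_mem _ fun b _ => Ideal.mul_mem_left _ _ b.2.1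
  have hlr : l = monomial μ 1 - r := eq_sub_of_add_eq hg.symm
  have hlμ : (lexOrder n).toSyn ((lexOrder n).degree l) ≤ (lexOrder n).toSyn μ := by
    rw [hl, Finsupp.linearCombination_apply]
    refine ((lexOrder n).degree_sum_le).trans (Finset.sup_le fun b _ => ?_)
    change (lexOrder n).toSyn ((lexOrder n).degree (g b * (b : MvPolynomial (Fin n) K))) ≤ _
    rw [mul_comm]
    exact (hgd b).trans ((lexOrder n).degree_monomial_le 1)
  have hrμ : coeff μ r = 0 := by
    by_contra hc
    exact hr μ (mem_support_iff.2 hc) P₀ ⟨hP₀, h0⟩ le_rfl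
  have hcl : coeff μ l = 1 := by rw [hlr, coeff_sub, hrμ]; simp
  have hdeg : (lexOrder n).degree l = μ := by
    refine (lexOrder n).toSyn.injective (le_antisymm hlμ ((lexOrder n).le_degree ?_))
    rw [mem_support_iff, hcl]; exact one_ne_zero
  refine ⟨l, hlI, ?_, hdeg, fun m hm hmd Q hQ hQ0 => hr m ?_ Q ⟨hQ, hQ0⟩⟩
  · rw [MonomialOrder.Monic, MonomialOrder.leadingCoeff, hdeg, hcl]
  · rw [hdeg] at hmd
    rw [mem_support_iff, hlr, coeff_sub, coeff_monomial, if_neg hmd.symm] at hm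
    rw [mem_support_iff]
    intro h; exact hm (by rw [h, sub_zero])

/-- The minimal leading exponents form an antichain, finite by Dickson's lemma; each is represented
by a monic polynomial with reduced tail. -/
theorem exists_isReducedGB (I : Ideal (MvPolynomial (Fin n) K)) : ∃ G, IsReducedGB G I := by
  classical
  set L : Set (Fin n →₀ ℕ) := (lexOrder n).degree '' {P | P ∈ I ∧ P ≠ 0} with hL
  set A : Set (Fin n →₀ ℕ) := {μ | Minimal (· ∈ L) μ} with hA
  have hfin : A.Finite := by
    apply WellQuasiOrderedLE.finite_of_isAntichain
    exact setOfPred_minimal_antichain _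
  have hmin : ∀ μ ∈ L, ∃ ν ∈ A, ν ≤ μ := fun μ hμ => by
    obtain ⟨ν, hν, hm⟩ := exists_minimal_le_of_wellFoundedLT (· ∈ L) μ hμ
    exact ⟨ν, hm, hν⟩
  have hex : ∀ μ : Fin n →₀ ℕ, ∃ P : MvPolynomial (Fin n) K, μ ∈ L →
      P ∈ I ∧ (lexOrder n).Monic P ∧ (lexOrder n).degree P = μ ∧
      ∀ m ∈ P.support, m ≠ (lexOrder n).degree P → ∀ Q ∈ I, Q ≠ 0 →
        ¬ (lexOrder n).degree Q ≤ m := by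
    intro μ
    by_cases hμ : μ ∈ L
    · obtain ⟨P₀, ⟨hP₀, h0⟩, rfl⟩ := hμ
      obtain ⟨P, hP⟩ := exists_monic_reduced hP₀ h0
      exact ⟨P, fun _ => hP⟩
    · exact ⟨0, fun h => absurd h hμ⟩
  choose f hf using hex
  have hfA : ∀ μ ∈ A, μ ∈ L := fun μ hμ => hμ.1
  refine ⟨hfin.toFinset.image f, ⟨?_, ?_⟩, ?_, ?_⟩
  · intro P hP
    simp only [Finset.coe_image, Set.Finite.coe_toFinset] at hP
    obtain ⟨μ, hμ, rfl⟩ := hP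
    exact (hf μ (hfA μ hμ)).1
  · apply le_antisymm
    · apply Ideal.span_mono
      apply Set.image_mono
      intro P hP
      simp only [Finset.coe_image, Set.Finite.coe_toFinset] at hP
      obtain ⟨μ, hμ, rfl⟩ := hP
      exact (hf μ (hfA μ hμ)).1
    · rw [Ideal.span_le]
      rintro _ ⟨P, hP, rfl⟩
      by_cases hP0 : P = 0
      · simp [hP0]
      obtain ⟨ν, hν, hle⟩ := hmin _ ⟨P, ⟨hP, hP0⟩, rfl⟩
      obtain ⟨-, h2, h3, -⟩ := hf ν (hfA ν hν)
      refine leadingTerm_mem_span_of_degree_le (lexOrder n) (Q := f ν) ?_ h2.ne_zero (by rwa [h3])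
      simp only [Finset.coe_image, Set.Finite.coe_toFinset]
      exact ⟨ν, hν, rfl⟩
  · intro P hP
    simp only [Finset.mem_image, Set.Finite.mem_toFinset] at hP
    obtain ⟨μ, hμ, rfl⟩ := hP
    exact (hf μ (hfA μ hμ)).2.1
  · intro P hP Q hQ hne m hm hle
    simp only [Finset.mem_image, Set.Finite.mem_toFinset] at hP hQ
    obtain ⟨μ, hμ, rfl⟩ := hP
    obtain ⟨ν, hν, rfl⟩ := hQ
    obtain ⟨-, -, h3, h4⟩ := hf μ (hfA μ hμ)
    obtain ⟨g1, g2, g3, -⟩ := hf ν (hfA ν hν)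
    by_cases hmd : m = (lexOrder n).degree (f μ)
    · rw [hmd, g3, h3] at hle
      exact hne (by rw [hμ.eq_of_le (hfA ν hν) hle])
    · exact h4 m hm hmd _ g1 g2.ne_zero hle

theorem exists_isWCharSet (I : Ideal (MvPolynomial (Fin n) K)) : ∃ T, IsWCharSet T I := by
  classical
  obtain ⟨G, hG⟩ := exists_isReducedGB I
  set S : Finset (MvPolynomial (Fin n) K) := G.filter fun P => ∀ Q ∈ G, lv Q = lv P →
      (lexOrder n).toSyn ((lexOrder n).degree P) ≤ (lexOrder n).toSyn ((lexOrder n).degree Q)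
    with hS
  -- Two smallest elements have equal degree, and a reduced basis has only one element of a given
  -- degree. Sorting by leading variable is therefore strict.
  have hinj : ∀ P ∈ S, ∀ Q ∈ S, lv P = lv Q → P = Q := by
    intro P hP Q hQ hPQ
    rw [hS, Finset.mem_filter] at hP hQ
    refine hG.degree_le hQ.1 hP.1 (le_of_eq ?_)
    exact (lexOrder n).toSyn.injective
      (le_antisymm (hP.2 Q hQ.1 hPQ.symm) (hQ.2 P hP.1 hPQ))
  let le : MvPolynomial (Fin n) K → MvPolynomial (Fin n) K → Bool :=
    fun P Q => decide (lv P ≤ lv Q)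
  have hsort : (S.toList.mergeSort le).Pairwise (fun P Q => lv P ≤ lv Q) := by
    have := List.pairwise_mergeSort (le := le)
      (fun a b c hab hbc => by
        simp only [le, decide_eq_true_eq] at *; exact hab.trans hbc)
      (fun a b => by simp only [le, Bool.or_eq_true, decide_eq_true_eq]; exact le_total _ _)
      S.toList
    simpa [le] using this
  have hnd : (S.toList.mergeSort le).Nodup :=
    (List.mergeSort_perm S.toList le).nodup_iff.2 S.nodup_toList
  have hmem : ∀ P, P ∈ S.toList.mergeSort le ↔ P ∈ S := fun P => by simp
  refine ⟨S.toList.mergeSort le, G, hG, ?_, fun P => by rw [hmem, hS, Finset.mem_filter]⟩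
  refine List.Pairwise.imp_of_mem ?_ (hsort.and hnd)
  intro P Q hP hQ h
  exact lt_of_le_of_ne h.1 fun he => h.2 (hinj P ((hmem P).1 hP) Q ((hmem Q).1 hQ) he)

theorem IsWCharSet.eq {T' : List (MvPolynomial (Fin n) K)} (h : IsWCharSet T I)
    (h' : IsWCharSet T' I) : T = T' := by
  obtain ⟨G, hG, hp, hm⟩ := h
  obtain ⟨G', hG', hp', hm'⟩ := h'
  obtain rfl := hG.eq hG'
  have hmem : ∀ P, P ∈ T ↔ P ∈ T' := fun P => (hm P).trans (hm' P).symm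
  have hnd : T.Nodup := hp.imp fun h => by rintro rfl; exact lt_irrefl _ h
  have hnd' : T'.Nodup := hp'.imp fun h => by rintro rfl; exact lt_irrefl _ h
  refine List.Perm.eq_of_pairwise (fun a b _ _ h1 h2 => absurd h1 h2.asymm) hp hp'
    ((List.perm_ext_iff_of_nodup hnd hnd').2 hmem)

end GroebnerBases

/-! ### Coefficients with respect to the higher variables, and initials. -/

section PartialCoefficients

/-- The polynomials in the variables `x_i` with `i < k`. -/
noncomputable abbrev low (K : Type*) [Field K] (n k : ℕ) : Subalgebra K (MvPolynomial (Fin n) K) :=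
  supported K {i : Fin n | i.val < k}

theorem mem_low_iff {k : ℕ} {P : MvPolynomial (Fin n) K} :
    P ∈ low K n k ↔ ∀ m ∈ P.support, ∀ i : Fin n, k ≤ i.val → m i = 0 := by
  rw [mem_supported]
  constructor
  · intro h m hm i hi
    by_contra hne
    have : i ∈ P.vars := (mem_vars_iff_mem_support i).2 ⟨m, hm, Finsupp.mem_support_iff.2 hne⟩
    exact absurd (h this) (by simpa using hi)
  · intro h i hi
    obtain ⟨m, hm, him⟩ := (mem_vars_iff_mem_support i).1 hi
    by_contra hne
    exact (Finsupp.mem_support_iff.1 him) (h m hm i (by simpa using hne))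

theorem low_mono {k l : ℕ} (h : k ≤ l) : low K n k ≤ low K n l :=
  supported_mono fun _ hi => lt_of_lt_of_le hi h

theorem low_self : low K n n = ⊤ := by
  rw [low, show {i : Fin n | i.val < n} = Set.univ from Set.eq_univ_of_forall fun i => i.2,
    supported_univ]

theorem lowerPart_add_upperPart (k : ℕ) (m : Fin n →₀ ℕ) :
    m.filter (fun i => i.val < k) + m.filter (fun i => k ≤ i.val) = m := by
  ext i
  by_cases h : i.val < k
  · simp [h]
  · simp [h, not_lt.1 h]

theorem upperPart_add {k : ℕ} {a e : Fin n →₀ ℕ} (ha : ∀ i : Fin n, k ≤ i.val → a i = 0)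
    (he : ∀ i : Fin n, i.val < k → e i = 0) : (a + e).filter (fun i => k ≤ i.val) = e := by
  ext i
  by_cases h : i.val < k
  · simp [h, he i h]
  · simp [not_lt.1 h, ha i (not_lt.1 h)]

/-- The coefficient of `P` at the term `e` in the variables `x_i` with `k ≤ i`. -/
noncomputable def coefHi (k : ℕ) (e : Fin n →₀ ℕ) (P : MvPolynomial (Fin n) K) :
    MvPolynomial (Fin n) K :=
  ∑ m ∈ P.support with m.filter (fun i => k ≤ i.val) = e,
    monomial (m.filter (fun i => i.val < k)) (P.coeff m)

theorem coeff_coefHi {k : ℕ} {e a : Fin n →₀ ℕ} (he : ∀ i : Fin n, i.val < k → e i = 0)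
    (ha : ∀ i : Fin n, k ≤ i.val → a i = 0) (P : MvPolynomial (Fin n) K) :
    coeff a (coefHi k e P) = coeff (a + e) P := by
  classical
  rw [coefHi, coeff_sum]
  simp only [coeff_monomial]
  -- Once the upper part is fixed, the lower part determines the exponent, so at most one summand
  -- contributes.
  have hiff : ∀ m : Fin n →₀ ℕ, m.filter (fun i => k ≤ i.val) = e →
      (m.filter (fun i => i.val < k) = a ↔ m = a + e) := by
    intro m hm
    have hm' := lowerPart_add_upperPart k m
    rw [hm] at hm'
    constructor
    · intro h; rw [← hm', h]
    · intro h
      rw [h] at hm'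
      rw [h]
      exact add_right_cancel hm'
  rw [Finset.sum_congr rfl (g := fun m => if m = a + e then coeff m P else 0)
    (fun m hm => by simp only [hiff m (Finset.mem_filter.1 hm).2])]
  rw [Finset.sum_ite_eq']
  split_ifs with hmem
  · rfl
  · rw [Finset.mem_filter, mem_support_iff] at hmem
    by_contra hc
    exact hmem ⟨Ne.symm hc, upperPart_add ha he⟩

theorem coefHi_mem_low (k : ℕ) (e : Fin n →₀ ℕ) (P : MvPolynomial (Fin n) K) :
    coefHi k e P ∈ low K n k := by
  refine Subalgebra.sum_mem _ fun m _ => ?_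
  rw [mem_low_iff]
  intro a ha i hi
  rw [Finset.mem_singleton.1 (support_monomial_subset ha)]
  simp [not_lt.2 hi]

theorem ext_low {k : ℕ} {P Q : MvPolynomial (Fin n) K} (hP : P ∈ low K n k) (hQ : Q ∈ low K n k)
    (h : ∀ a : Fin n →₀ ℕ, (∀ i : Fin n, k ≤ i.val → a i = 0) → coeff a P = coeff a Q) :
    P = Q := by
  ext a
  by_cases ha : ∀ i : Fin n, k ≤ i.val → a i = 0
  · exact h a ha
  · have hz : ∀ R ∈ low K n k, coeff a R = 0 := fun R hR => by
      by_contra hc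
      exact ha (mem_low_iff.1 hR a (mem_support_iff.2 hc))
    rw [hz P hP, hz Q hQ]

theorem coefHi_add {k : ℕ} {e : Fin n →₀ ℕ} (he : ∀ i : Fin n, i.val < k → e i = 0)
    (P Q : MvPolynomial (Fin n) K) : coefHi k e (P + Q) = coefHi k e P + coefHi k e Q := by
  refine ext_low (coefHi_mem_low k e _)
    (add_mem (coefHi_mem_low k e P) (coefHi_mem_low k e Q)) fun a ha => ?_
  rw [coeff_add, coeff_coefHi he ha, coeff_coefHi he ha, coeff_coefHi he ha, coeff_add]

/-- A factor in the lower variables leaves the upper part of every exponent unchanged. Linearity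
over `low K n k` is what lets membership questions be checked coefficient by coefficient. -/
theorem coefHi_mul {k : ℕ} {e : Fin n →₀ ℕ} (he : ∀ i : Fin n, i.val < k → e i = 0)
    {A : MvPolynomial (Fin n) K} (hA : A ∈ low K n k) (P : MvPolynomial (Fin n) K) :
    coefHi k e (A * P) = A * coefHi k e P := by
  refine ext_low (coefHi_mem_low k e _) (mul_mem hA (coefHi_mem_low k e P)) fun a ha => ?_
  rw [coeff_coefHi he ha, A.as_sum, Finset.sum_mul, Finset.sum_mul, coeff_sum, coeff_sum]
  refine Finset.sum_congr rfl fun m hm => ?_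
  have hmk := mem_low_iff.1 hA m hm
  rw [coeff_monomial_mul', coeff_monomial_mul']
  have hle : m ≤ a + e ↔ m ≤ a := by
    simp only [Finsupp.le_def, Finsupp.add_apply]
    refine forall_congr' fun i => ?_
    by_cases hi : i.val < k
    · rw [he i hi, add_zero]
    · simp [hmk i (not_lt.1 hi)]
  simp only [hle]
  split_ifs with hma
  · rw [coeff_coefHi he (fun i hi => by simp [ha i hi]), tsub_add_eq_add_tsub hma]
  · rfl

/-- The terms of `P - coefHi k e P * x ^ e` are those terms of `P` that do not have `e` as their
part in the variables `x_i` with `k ≤ i`. -/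
theorem mem_support_sub_coefHi {k : ℕ} {e a : Fin n →₀ ℕ}
    (he : ∀ i : Fin n, i.val < k → e i = 0) {P : MvPolynomial (Fin n) K}
    (ha : a ∈ (P - coefHi k e P * monomial e 1).support) :
    a ∈ P.support ∧ ∃ i : Fin n, k ≤ i.val ∧ a i ≠ e i := by
  have hex : ∃ i : Fin n, k ≤ i.val ∧ a i ≠ e i := by
    by_contra hcon
    push Not at hcon
    have hle : e ≤ a := fun i => by
      by_cases hi : i.val < k
      · rw [he i hi]; exact Nat.zero_le _
      · rw [hcon i (not_lt.1 hi)]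
    rw [mem_support_iff, coeff_sub, coeff_mul_monomial', if_pos hle, mul_one,
      coeff_coefHi he (fun i hi => by simp [hcon i hi]), tsub_add_cancel_of_le hle, sub_self] at ha
    exact ha rfl
  refine ⟨?_, hex⟩
  obtain ⟨i, hi, hne⟩ := hex
  have hz : coeff a (coefHi k e P * monomial e 1) = 0 := by
    rw [coeff_mul_monomial']
    split_ifs with hle
    · rw [mul_one]
      by_contra hc
      have := mem_low_iff.1 (coefHi_mem_low k e P) _ (mem_support_iff.2 hc) i hi
      rw [Finsupp.tsub_apply] at this
      have := hle i
      omega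
    · rfl
  rw [mem_support_iff, coeff_sub, hz, sub_zero] at ha
  exact mem_support_iff.2 ha

theorem eq_sum_coefHi (k : ℕ) (P : MvPolynomial (Fin n) K) :
    P = ∑ e ∈ P.support.image (fun m => m.filter (fun i => k ≤ i.val)),
      coefHi k e P * monomial e 1 := by
  classical
  have hmem : ∀ m ∈ P.support, m.filter (fun i : Fin n => k ≤ i.val) ∈
      P.support.image (fun m => m.filter (fun i : Fin n => k ≤ i.val)) := fun m hm =>
    Finset.mem_image_of_mem (fun m : Fin n →₀ ℕ => m.filter (fun i : Fin n => k ≤ i.val)) hm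
  conv_lhs => rw [P.as_sum, ← Finset.sum_fiberwise_of_maps_to hmem]
  refine Finset.sum_congr rfl fun e _ => ?_
  rw [coefHi, Finset.sum_mul]
  refine Finset.sum_congr rfl fun m hm => ?_
  rw [monomial_mul, mul_one, ← (Finset.mem_filter.1 hm).2, lowerPart_add_upperPart]

section Initial

variable {P : MvPolynomial (Fin n) K} {j : Fin n}

theorem eq_zero_of_lv_lt (h : lv P = j) {m : Fin n →₀ ℕ} (hm : m ∈ P.support) {i : Fin n}
    (hi : j < i) : m i = 0 := by
  by_contra hne
  have : i ∈ P.vars := (mem_vars_iff_mem_support i).2 ⟨m, hm, Finsupp.mem_support_iff.2 hne⟩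
  have := Finset.le_max this
  rw [show P.vars.max = lv P from rfl, h] at this
  exact absurd (WithBot.coe_le_coe.1 this) (not_le.2 hi)

theorem low_of_lv (h : lv P = j) : P ∈ low K n (j.val + 1) :=
  mem_low_iff.2 fun _ hm _ hi => eq_zero_of_lv_lt h hm (Fin.lt_def.2 (Nat.lt_of_succ_le hi))

theorem degreeOf_pos_of_lv (h : lv P = j) : 0 < P.degreeOf j := by
  have hj : j ∈ P.vars := Finset.mem_of_max h
  obtain ⟨m, hm, hjm⟩ := (mem_vars_iff_mem_support j).1 hj
  exact lt_of_lt_of_le (Nat.pos_of_ne_zero (Finsupp.mem_support_iff.1 hjm))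
    (monomial_le_degreeOf j hm)

theorem lv_le_of_mem_low {k : ℕ} (hP : P ∈ low K n k) (h : lv P = j) : j.val < k :=
  mem_supported.1 hP (Finset.mem_of_max h)

/-- No variable above `x_j` occurs, so the exponent of `x_j` is the first one that the lexicographic
order compares. -/
theorem degree_apply_of_lv (h : lv P = j) : (lexOrder n).degree P j = P.degreeOf j := by
  have hP0 : P ≠ 0 := by
    rintro rfl
    have := degreeOf_pos_of_lv h
    simp at this
  refine le_antisymm (monomial_le_degreeOf j ((lexOrder n).degree_mem_support hP0)) ?_
  rw [degreeOf_le_iff]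
  intro m hm
  by_contra! hlt
  refine absurd ((lexOrder n).le_degree hm) (not_le.2 ((lexOrder_lt_iff _ _).2 ⟨j, ?_, hlt⟩))
  intro i hi
  rw [eq_zero_of_lv_lt h hm hi, eq_zero_of_lv_lt h ((lexOrder n).degree_mem_support hP0) hi]

theorem ini_eq_coefHi (h : lv P = j) :
    ini P = coefHi j.val (Finsupp.single j (P.degreeOf j)) P := by
  have hini : ini P = coeffTop j P := by
    unfold ini; rw [h]; rfl
  rw [hini, coeffTop, coefHi]
  have hup : ∀ m ∈ P.support, m.filter (fun i : Fin n => j.val ≤ i.val) = Finsupp.single j (m j) := by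
    intro m hm
    ext i
    rcases lt_trichotomy i j with hi | rfl | hi
    · simp [hi.ne', hi]
    · simp
    · simp [hi.ne, hi.le, eq_zero_of_lv_lt h hm hi]
  refine Finset.sum_congr (Finset.filter_congr fun m hm => ?_) fun m hm => ?_
  · rw [hup m hm]
    exact ⟨fun h => by rw [h], fun h => by simpa using DFunLike.congr_fun h j⟩
  · suffices m.erase j = m.filter (fun i : Fin n => i.val < j.val) by rw [this]
    ext i
    rcases lt_trichotomy i j with hi | rfl | hi
    · simp [Finsupp.erase_ne hi.ne, hi]
    · simp
    · simp [Finsupp.erase_ne hi.ne', not_lt.2 hi.le,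
        eq_zero_of_lv_lt h (Finset.mem_filter.1 hm).1 hi]

theorem ini_mem_low (h : lv P = j) : ini P ∈ low K n j.val := by
  rw [ini_eq_coefHi h]; exact coefHi_mem_low _ _ _

theorem eq_C_of_lv_eq_bot (h : lv P = ⊥) : P = C (coeff 0 P) := by
  have hv : P.vars = ∅ := Finset.max_eq_bot.1 h
  ext m
  by_cases hm : m = 0
  · simp [hm]
  · rw [coeff_C, if_neg (Ne.symm hm)]
    by_contra hc
    obtain ⟨i, hi⟩ := Finsupp.ne_iff.1 hm
    have : i ∈ P.vars := (mem_vars_iff_mem_support i).2 ⟨m, mem_support_iff.2 hc, Finsupp.mem_support_iff.2 hi⟩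
    simp [hv] at this

theorem ini_of_lv_eq_bot (h : lv P = ⊥) : ini P = P := by
  unfold ini; rw [h]; rfl

/-- Pseudo-reduction of the leading part of `P` by `t` decreases the lexicographic degree. -/
theorem exists_lt_degree_of_lv {t : MvPolynomial (Fin n) K} (ht : lv t = j)
    (hle : t.degreeOf j ≤ (lexOrder n).degree P j) :
    ∃ q, (∀ k, P ∈ low K n k → j.val < k → q ∈ low K n k) ∧
      ∀ a ∈ (ini t * P - q * t).support,
        (lexOrder n).toSyn a < (lexOrder n).toSyn ((lexOrder n).degree P) := by
  classical
  set μ := (lexOrder n).degree P with hμ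
  set d := t.degreeOf j with hd
  set e : Fin n →₀ ℕ := μ.filter (fun i => j.val ≤ i.val) with he
  have hej : ∀ i : Fin n, j.val ≤ i.val → e i = μ i := fun i hi => Finsupp.filter_apply_pos _ _ hi
  have he0 : ∀ i : Fin n, i.val < j.val → e i = 0 := fun i hi =>
    Finsupp.filter_apply_neg _ _ (not_le.2 hi)
  have hdl : Finsupp.single j d ≤ e := by
    rw [Finsupp.single_le_iff, hej j le_rfl]; exact hle
  have hs0 : ∀ i : Fin n, i.val < j.val → Finsupp.single j d i = 0 := fun i hi => by
    rw [Finsupp.single_eq_of_ne]; rintro rfl; exact lt_irrefl _ hi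
  -- Here `e` is the part of the leading exponent of `P` in the variables from `x_j` on. The
  -- multiplier makes the whole block of `ini t * P` at `x ^ e` cancel against the top part of `t`
  -- in `x_j`, not merely the leading term.
  refine ⟨coefHi j.val e P * monomial (e - Finsupp.single j d) 1, fun k hk hjk => ?_, ?_⟩
  · refine mul_mem (low_mono hjk.le (coefHi_mem_low _ _ _)) ?_
    rw [mem_low_iff]
    intro a ha i hi
    rw [Finset.mem_singleton.1 (support_monomial_subset ha)]
    have : e i = 0 := by
      rw [hej i (hjk.le.trans hi)]
      by_cases hP0 : P = 0
      · simp [hμ, hP0]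
      · exact mem_low_iff.1 hk μ ((lexOrder n).degree_mem_support hP0) i hi
    simp [this]
  · have key : ini t * P - coefHi j.val e P * monomial (e - Finsupp.single j d) 1 * t
        = ini t * (P - coefHi j.val e P * monomial e 1)
          - coefHi j.val e P * monomial (e - Finsupp.single j d) 1 *
            (t - ini t * monomial (Finsupp.single j d) 1) := by
      have : (monomial e (1 : K)) = monomial (e - Finsupp.single j d) 1 *
          monomial (Finsupp.single j d) 1 := by
        rw [monomial_mul, tsub_add_cancel_of_le hdl, mul_one]
      rw [this]; ring
    rw [key]
    intro a ha
    have hlow := mem_low_iff.1 (ini_mem_low ht)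
    rcases Finset.mem_union.1 (support_sub (Fin n) _ _ ha) with ha | ha
    -- The remaining terms of `P` are smaller than `μ` already in the variables from `x_j` on, and
    -- multiplying by `ini t` only changes lower variables.
    · obtain ⟨b, hb, c, hc, rfl⟩ := Finset.mem_add.1 (support_mul _ _ ha)
      obtain ⟨hcP, i, hi, hci⟩ := mem_support_sub_coefHi he0 hc
      rw [hej i hi] at hci
      have hclt : (lexOrder n).toSyn c < (lexOrder n).toSyn μ :=
        lt_of_le_of_ne ((lexOrder n).le_degree hcP) fun h =>
          hci (by rw [(lexOrder n).toSyn.injective h])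
      obtain ⟨l, hl, hcl⟩ := (lexOrder_lt_iff _ _).1 hclt
      have hil : i ≤ l := not_lt.1 fun h => hci (hl i h)
      have hjl : j.val ≤ l.val := hi.trans hil
      refine (lexOrder_lt_iff _ _).2 ⟨l, fun i' hi' => ?_, ?_⟩
      · rw [Finsupp.add_apply, hlow b hb i' (hjl.trans hi'.le), zero_add, hl i' hi']
      · rw [Finsupp.add_apply, hlow b hb l hjl, zero_add]; exact hcl
    -- The tail of `t` has degree less than `d` in `x_j`, so the exponent of `x_j` drops below that
    -- of `μ` while the exponents above it agree.
    · obtain ⟨b', hb', c, hc, rfl⟩ := Finset.mem_add.1 (support_mul _ _ ha)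
      obtain ⟨b, hb, b'', hb'', rfl⟩ := Finset.mem_add.1 (support_mul _ _ hb')
      rw [Finset.mem_singleton.1 (support_monomial_subset hb'')]
      have hbl := mem_low_iff.1 (coefHi_mem_low j.val e P) b hb
      rw [ini_eq_coefHi ht] at hc
      obtain ⟨hct, i, hi, hci⟩ := mem_support_sub_coefHi hs0 hc
      have hcj : c j < d := by
        refine lt_of_le_of_ne (monomial_le_degreeOf j hct) fun h => hci ?_
        rcases eq_or_lt_of_le (Fin.le_def.2 hi) with rfl | hlt
        · simpa using h
        · rw [eq_zero_of_lv_lt ht hct hlt, Finsupp.single_eq_of_ne hlt.ne']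
      refine (lexOrder_lt_iff _ _).2 ⟨j, fun i' hi' => ?_, ?_⟩
      · simp [hbl i' hi'.le, hej i' hi'.le, eq_zero_of_lv_lt ht hct hi', hi'.ne']
      · have := hdl j
        simp only [Finsupp.single_eq_same] at this
        simp only [Finsupp.add_apply, hbl j le_rfl, Finsupp.tsub_apply, Finsupp.single_eq_same,
          zero_add]
        rw [← hej j le_rfl]
        omega

end Initial

end PartialCoefficients

/-! ### Pseudo-reduction by the W-characteristic set, regularity, and branching. -/

section PseudoReduction

variable {I : Ideal (MvPolynomial (Fin n) K)} {G : Finset (MvPolynomial (Fin n) K)}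
  {T : List (MvPolynomial (Fin n) K)}

theorem IsReducedGB.eq_one_of_lv_eq_bot (h : IsReducedGB G I) {P : MvPolynomial (Fin n) K}
    (hP : P ∈ G) (hlv : lv P = ⊥) : P = 1 := by
  have hC := eq_C_of_lv_eq_bot hlv
  have hm := (h.2.1 P hP).leadingCoeff_eq_one
  rw [hC, MonomialOrder.leadingCoeff_C] at hm
  rw [hC, hm, C_1]

theorem IsReducedGB.eq_one (h : IsReducedGB G I) (h1 : 1 ∈ G) {P : MvPolynomial (Fin n) K}
    (hP : P ∈ G) : P = 1 :=
  (h.degree_le hP h1 (by rw [MonomialOrder.degree_one]; exact zero_le)).symm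

theorem IsReducedGB.one_mem (h : IsReducedGB G I) (hI : I = ⊤) : 1 ∈ G := by
  obtain ⟨Q, hQ, -, hle⟩ := h.1.exists_degree_le (P := 1) (by simp [hI]) one_ne_zero
  rw [MonomialOrder.degree_one] at hle
  have hC := (lexOrder n).eq_C_of_degree_eq_zero (le_antisymm hle zero_le)
  rw [(h.2.1 Q hQ).leadingCoeff_eq_one, C_1] at hC
  rwa [← hC]

theorem exists_isLeast_lv {P : MvPolynomial (Fin n) K} (hP : P ∈ G) :
    ∃ t ∈ G, lv t = lv P ∧ ∀ Q ∈ G, lv Q = lv P →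
      (lexOrder n).toSyn ((lexOrder n).degree t) ≤ (lexOrder n).toSyn ((lexOrder n).degree Q) := by
  classical
  obtain ⟨t, ht, hmin⟩ := Finset.exists_min_image (G.filter fun Q => lv Q = lv P)
    (fun Q => (lexOrder n).toSyn ((lexOrder n).degree Q)) ⟨P, Finset.mem_filter.2 ⟨hP, rfl⟩⟩
  rw [Finset.mem_filter] at ht
  exact ⟨t, ht.1, ht.2, fun Q hQ hlv => hmin Q (Finset.mem_filter.2 ⟨hQ, hlv⟩)⟩

theorem IsWCharSet.subset (h : IsWCharSet T I) {P : MvPolynomial (Fin n) K} (hP : P ∈ T) :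
    P ∈ I := by
  obtain ⟨G, hG, -, hm⟩ := h
  exact hG.1.1 ((hm P).1 hP).1

/-- Pseudo-reduction with respect to the W-characteristic set, in the variables `x_i` with
`i < k`. -/
theorem IsWCharSet.exists_mul_mem_span (h : IsWCharSet T I) (k : ℕ) {P : MvPolynomial (Fin n) K}
    (hPI : P ∈ I) (hPk : P ∈ low K n k) :
    ∃ s ∈ Submonoid.closure (ini '' {t | t ∈ T ∧ t ∈ low K n k}),
      s * P ∈ Ideal.span {t | t ∈ T ∧ t ∈ low K n k} := by
  obtain ⟨G, hG, -, hm⟩ := h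
  induction hd : (lexOrder n).toSyn ((lexOrder n).degree P) using WellFoundedLT.induction
    generalizing P with
  | ind d ih =>
  by_cases hP0 : P = 0
  · exact ⟨1, one_mem _, by simp [hP0]⟩
  obtain ⟨Q, hQ, -, hQP⟩ := hG.1.exists_degree_le hPI hP0
  obtain ⟨t, htG, htlv, hmin⟩ := exists_isLeast_lv hQ
  have htT : t ∈ T := (hm t).2 ⟨htG, fun R hR hlv => hmin R hR (hlv.trans htlv)⟩
  cases hlv : lv Q with
  | bot =>
    obtain rfl := hG.eq_one_of_lv_eq_bot htG (htlv.trans hlv)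
    exact ⟨1, one_mem _, by
      rw [one_mul, ← mul_one P]
      exact Ideal.mul_mem_left _ _ (Ideal.subset_span ⟨htT, one_mem _⟩)⟩
  | coe j =>
    have htj : lv t = j := htlv.trans hlv
    -- The leading term of `Q` divides that of `P`, so `x_j` occurs in `P`. Thus only elements of
    -- `T` in the first `k` variables are ever used.
    have hjk : j.val < k := by
      by_contra hjk
      have h0 := mem_low_iff.1 hPk _ ((lexOrder n).degree_mem_support hP0) j (not_lt.1 hjk)
      have h1 := hQP j
      rw [h0, degree_apply_of_lv hlv] at h1
      exact absurd (degreeOf_pos_of_lv hlv) (not_lt.2 h1)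
    have htk : t ∈ low K n k := low_mono (Nat.succ_le_of_lt hjk) (low_of_lv htj)
    -- The leading term of `t` need not divide that of `P`. Minimality among the basis elements with
    -- the same leading variable bounds its degree in `x_j`, which suffices for pseudo-division.
    have htQ : (lexOrder n).degree t j ≤ (lexOrder n).degree Q j := by
      by_contra! hlt
      refine absurd (hmin Q hQ rfl) (not_le.2 ((lexOrder_lt_iff _ _).2 ⟨j, fun i hi => ?_, hlt⟩))
      rw [eq_zero_of_lv_lt htj ((lexOrder n).degree_mem_support (hG.2.1 t htG).ne_zero) hi,
        eq_zero_of_lv_lt hlv ((lexOrder n).degree_mem_support (hG.2.1 Q hQ).ne_zero) hi]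
    obtain ⟨q, hqk, hlt⟩ := exists_lt_degree_of_lv (P := P) htj
      (by rw [← degree_apply_of_lv htj]; exact htQ.trans (hQP j))
    have hini : ini t ∈ Submonoid.closure (ini '' {t | t ∈ T ∧ t ∈ low K n k}) :=
      Submonoid.subset_closure ⟨t, ⟨htT, htk⟩, rfl⟩
    have htspan : q * t ∈ Ideal.span {t | t ∈ T ∧ t ∈ low K n k} :=
      Ideal.mul_mem_left _ _ (Ideal.subset_span ⟨htT, htk⟩)
    by_cases hP'0 : ini t * P - q * t = 0
    · exact ⟨ini t, hini, by rwa [sub_eq_zero.1 hP'0]⟩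
    · obtain ⟨s, hs, hsP⟩ := ih _
        (hd ▸ hlt _ ((lexOrder n).degree_mem_support hP'0))
        (I.sub_mem (I.mul_mem_left _ hPI) (I.mul_mem_left _ (hG.1.1 htG)))
        (sub_mem (mul_mem (low_mono hjk.le (ini_mem_low htj)) hPk) (mul_mem (hqk k hPk hjk) htk))
        rfl
      refine ⟨s * ini t, mul_mem hs hini, ?_⟩
      have := Ideal.add_mem _ hsP (Ideal.mul_mem_left _ s htspan)
      rwa [mul_sub, sub_add_cancel, ← mul_assoc] at this

theorem exists_dvd_iniProd_pow {s : MvPolynomial (Fin n) K}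
    (hs : s ∈ Submonoid.closure (ini '' {t | t ∈ T})) : ∃ N, s ∣ iniProd T ^ N := by
  induction hs using Submonoid.closure_induction with
  | mem x hx =>
    obtain ⟨t, ht, rfl⟩ := hx
    exact ⟨1, by rw [pow_one]; exact List.dvd_prod (List.mem_map_of_mem ht)⟩
  | one => exact ⟨0, by simp⟩
  | mul x y _ _ hx hy =>
    obtain ⟨a, ha⟩ := hx
    obtain ⟨b, hb⟩ := hy
    exact ⟨a + b, by rw [pow_add]; exact mul_dvd_mul ha hb⟩

theorem mem_sat {P : MvPolynomial (Fin n) K} :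
    P ∈ sat T ↔ ∃ k : ℕ, P * iniProd T ^ k ∈ listIdeal T := Iff.rfl

theorem listIdeal_le_sat : listIdeal T ≤ sat T := fun P hP => ⟨0, by simpa using hP⟩

/-- The ideal `sat T` is saturated with respect to the products of initials. -/
theorem mem_sat_of_mul_mem_sat {s P : MvPolynomial (Fin n) K}
    (hs : s ∈ Submonoid.closure (ini '' {t | t ∈ T})) (h : s * P ∈ sat T) : P ∈ sat T := by
  obtain ⟨N, c, hc⟩ := exists_dvd_iniProd_pow hs
  obtain ⟨m, hm⟩ := h
  refine ⟨N + m, ?_⟩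
  have : P * iniProd T ^ (N + m) = c * (s * P * iniProd T ^ m) := by
    rw [pow_add, hc]; ring
  rw [this]
  exact Ideal.mul_mem_left _ _ hm

theorem IsWCharSet.le_sat (h : IsWCharSet T I) : I ≤ sat T := by
  intro P hP
  obtain ⟨s, hs, hsP⟩ := h.exists_mul_mem_span n hP (by rw [low_self]; trivial)
  simp only [low_self, Algebra.mem_top, and_true] at hs hsP
  exact mem_sat_of_mul_mem_sat hs (listIdeal_le_sat hsP)

theorem IsWCharSet.eq_singleton_one (h : IsWCharSet T I) {t : MvPolynomial (Fin n) K}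
    (ht : t ∈ T) (hlv : lv t = ⊥) : T = [1] := by
  obtain ⟨G, hG, hp, hm⟩ := h
  have ht1 := hG.eq_one_of_lv_eq_bot ((hm t).1 ht).1 hlv
  subst ht1
  have hall : ∀ s ∈ T, s = 1 := fun s hs => hG.eq_one ((hm 1).1 ht).1 ((hm s).1 hs).1
  match T, ht, hp, hall with
  | [a], _, _, hall => rw [hall a (by simp)]
  | a :: b :: l, _, hp, hall =>
    have := List.rel_of_pairwise_cons hp (List.mem_cons_self (a := b) (l := l))
    rw [hall a (by simp), hall b (by simp)] at this
    exact absurd this (lt_irrefl _)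

theorem IsWCharSet.lv_eq_bot (h : IsWCharSet T I) (hI : I = ⊤) {t : MvPolynomial (Fin n) K}
    (ht : t ∈ T) : lv t = ⊥ := by
  obtain ⟨G, hG, -, hm⟩ := h
  rw [hG.eq_one (hG.one_mem hI) ((hm t).1 ht).1, lv, vars_one, Finset.max_empty]

theorem IsWCharSet.isTriangularSet (h : IsWCharSet T I) : IsTriangularSet T := by
  by_cases hb : ∃ t ∈ T, lv t = ⊥
  · obtain ⟨t, ht, hlv⟩ := hb
    exact Or.inr ⟨1, one_ne_zero, by rw [h.eq_singleton_one ht hlv, C_1]⟩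
  · push Not at hb
    obtain ⟨G, -, hp, -⟩ := h
    exact Or.inl ⟨hb, hp⟩

/-- The initial segments of a list with increasing leading variables consist of the polynomials in
fewer variables. -/
theorem mem_take_iff_mem_low (hp : T.Pairwise (fun P Q => lv P < lv Q)) {i : ℕ}
    (hi : i < T.length) {j : Fin n} (hj : lv T[i] = j) (t : MvPolynomial (Fin n) K) :
    t ∈ T.take i ↔ t ∈ T ∧ t ∈ low K n j.val := by
  rw [List.pairwise_iff_getElem] at hp
  constructor
  · intro ht
    obtain ⟨l, hl, rfl⟩ := List.mem_take_iff_getElem.1 ht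
    have hli : l < i := lt_of_lt_of_le hl (min_le_left _ _)
    have hlt := hp l i (hli.trans hi) hi hli
    refine ⟨List.getElem_mem _, ?_⟩
    rw [hj] at hlt
    cases hlv : lv T[l] with
    | bot => rw [eq_C_of_lv_eq_bot hlv]; exact Subalgebra.algebraMap_mem _ _
    | coe j' =>
      rw [hlv, WithBot.coe_lt_coe, Fin.lt_def] at hlt
      exact low_mono (Nat.succ_le_of_lt hlt) (low_of_lv hlv)
  · rintro ⟨ht, htl⟩
    obtain ⟨l, hl, rfl⟩ := List.getElem_of_mem ht
    rcases lt_trichotomy l i with hli | rfl | hli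
    · exact List.mem_take_iff_getElem.2 ⟨l, lt_min hli hl, rfl⟩
    · exact absurd (lv_le_of_mem_low htl hj) (lt_irrefl _)
    · have hlt := hp i l hi hl hli
      rw [hj] at hlt
      cases hlv : lv T[l] with
      | bot => rw [hlv] at hlt; exact absurd hlt not_lt_bot
      | coe j' =>
        rw [hlv, WithBot.coe_lt_coe, Fin.lt_def] at hlt
        exact absurd (lv_le_of_mem_low htl hlv) hlt.asymm

theorem coefHi_mem_span {k : ℕ} {e : Fin n →₀ ℕ} (he : ∀ i : Fin n, i.val < k → e i = 0)
    {D : Set (MvPolynomial (Fin n) K)} (hD : ∀ t ∈ D, t ∈ low K n k) {P : MvPolynomial (Fin n) K}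
    (hP : P ∈ Ideal.span D) : coefHi k e P ∈ Ideal.span D := by
  induction hP using Submodule.span_induction with
  | mem x hx =>
    rw [← mul_one x, coefHi_mul he (hD x hx)]
    exact Ideal.mul_mem_right _ _ (Ideal.subset_span hx)
  | zero => simp [coefHi]
  | add x y _ _ hx hy => rw [coefHi_add he]; exact Ideal.add_mem _ hx hy
  | smul a x hx ih =>
    -- The coefficient map is not linear over all of the ring, so the hypothesis for `x` says
    -- nothing about `a * x`; the induction is redone for all multipliers at once.
    clear ih
    rw [smul_eq_mul]
    induction hx using Submodule.span_induction generalizing a with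
    | mem x hx =>
      rw [mul_comm, coefHi_mul he (hD x hx)]
      exact Ideal.mul_mem_right _ _ (Ideal.subset_span hx)
    | zero => simp [coefHi]
    | add x y _ _ hx hy => rw [mul_add, coefHi_add he]; exact Ideal.add_mem _ (hx a) (hy a)
    | smul b x _ ih => rw [smul_eq_mul, ← mul_assoc]; exact ih (a * b)

/-- Let `D` be the part of `T` before `T_i`. If `ini T_i * Q ∈ sat D`, so does every coefficient of
`Q` in the variables from the leading variable of `T_i` on. Such a coefficient lies in `sat T = I`
and involves only lower variables, so pseudo-reducing it uses only `D` and puts it in `sat D`. -/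
theorem IsWCharSet.isRegularSet (h : IsWCharSet T I) (hsat : sat T = I) : IsRegularSet T := by
  refine ⟨h.isTriangularSet, fun i => ?_⟩
  rw [mem_nonZeroDivisors_iff_right, Ne, Ideal.Quotient.eq_zero_iff_mem, List.get_eq_getElem]
  cases hj : lv T[i.val] with
  | bot =>
    have hT1 := h.eq_singleton_one (List.getElem_mem _) hj
    have hall : ∀ t ∈ T, t = 1 := by rw [hT1]; simp
    have hini : ini T[i.val] = 1 := by
      rw [ini_of_lv_eq_bot hj, hall _ (List.getElem_mem _)]
    have hi0 : i.val = 0 := by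
      have hl : T.length = 1 := by simpa using congrArg List.length hT1
      have := i.2
      omega
    rw [hini]
    refine ⟨?_, fun x hx => by simpa using hx⟩
    rw [hi0, List.take_zero]
    rintro ⟨k, hk⟩
    simp [listIdeal, iniProd] at hk
  | coe j =>
    have hI : I ≠ ⊤ := fun hI => by
      rw [h.lv_eq_bot hI (List.getElem_mem _)] at hj
      exact WithBot.bot_ne_coe hj
    have hp : T.Pairwise (fun P Q => lv P < lv Q) := by
      obtain ⟨G, -, hp, -⟩ := h
      exact hp
    have hD := mem_take_iff_mem_low hp i.2 hj
    set D := T.take i.val with hDdef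
    have hDset : {t | t ∈ D} = {t | t ∈ T ∧ t ∈ low K n j.val} := Set.ext hD
    have hDI : listIdeal D ≤ I := Ideal.span_le.2 fun t ht => h.subset ((hD t).1 ht).1
    have hDJ : iniProd D ∈ low K n j.val := by
      refine list_prod_mem fun x hx => ?_
      obtain ⟨t, ht, rfl⟩ := List.mem_map.1 hx
      have htl := ((hD t).1 ht).2
      cases hlv : lv t with
      | bot => rwa [ini_of_lv_eq_bot hlv]
      | coe j' => exact low_mono (lv_le_of_mem_low htl hlv).le (ini_mem_low hlv)
    have hcl : ∀ m, ini T[i.val] * iniProd D ^ m ∈ Submonoid.closure (ini '' {t | t ∈ T}) := by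
      intro m
      refine mul_mem (Submonoid.subset_closure ⟨_, List.getElem_mem _, rfl⟩) (pow_mem ?_ m)
      refine list_prod_mem fun x hx => ?_
      obtain ⟨t, ht, rfl⟩ := List.mem_map.1 hx
      exact Submonoid.subset_closure ⟨t, ((hD t).1 ht).1, rfl⟩
    constructor
    · rintro ⟨m, hm⟩
      -- Were the initial in `sat D`, a product of initials of `T` would lie in `I = sat T`;
      -- cancelling it would give `1 ∈ I`.
      refine hI ((Ideal.eq_top_iff_one _).2 ?_)
      rw [← hsat]
      exact mem_sat_of_mul_mem_sat (hcl m) (by rw [mul_one, hsat]; exact hDI hm)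
    · intro x hx
      obtain ⟨Q, rfl⟩ := Ideal.Quotient.mk_surjective x
      rw [← map_mul, Ideal.Quotient.eq_zero_iff_mem] at hx
      rw [Ideal.Quotient.eq_zero_iff_mem]
      obtain ⟨m, hm⟩ := hx
      rw [eq_sum_coefHi j.val Q]
      refine Ideal.sum_mem _ fun e he => Ideal.mul_mem_right _ _ ?_
      obtain ⟨a, -, rfl⟩ := Finset.mem_image.1 he
      set e := a.filter (fun i : Fin n => j.val ≤ i.val)
      have he0 : ∀ i : Fin n, i.val < j.val → e i = 0 := fun i hi =>
        Finsupp.filter_apply_neg _ _ (not_le.2 hi)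
      have h1 := coefHi_mem_span he0 (fun t ht => ((hD t).1 ht).2) hm
      rw [mul_assoc, mul_comm, coefHi_mul he0 (mul_mem (ini_mem_low hj) (pow_mem hDJ m))] at h1
      have h2 : coefHi j.val e Q ∈ I := by
        rw [← hsat]
        exact mem_sat_of_mul_mem_sat (hcl m) (by rw [hsat]; exact hDI h1)
      obtain ⟨s, hs, hsQ⟩ := h.exists_mul_mem_span j.val h2 (coefHi_mem_low _ _ _)
      rw [← hDset] at hs hsQ
      exact mem_sat_of_mul_mem_sat hs (listIdeal_le_sat hsQ)

/-- If `ini t` were in `I`, its leading term would be divisible by that of some `Q` in the reduced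
basis. Times a power of `x_j` it is a term of `t`, so reducedness forces `Q = t`; but `x_j` does not
occur in `ini t`. -/
theorem IsWCharSet.ini_notMem (h : IsWCharSet T I) {t : MvPolynomial (Fin n) K} (ht : t ∈ T)
    {j : Fin n} (hj : lv t = j) : ini t ∉ I := by
  obtain ⟨G, hG, -, hm⟩ := h
  have htG := ((hm t).1 ht).1
  have ht0 := (hG.2.1 t htG).ne_zero
  have hs0 : ∀ i : Fin n, i.val < j.val → Finsupp.single j (t.degreeOf j) i = 0 := fun i hi => by
    rw [Finsupp.single_eq_of_ne]; rintro rfl; exact lt_irrefl _ hi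
  have hlow := mem_low_iff.1 (ini_mem_low hj)
  have hini0 : ini t ≠ 0 := by
    intro h0
    have hmem := (lexOrder n).degree_mem_support ht0
    have hmem' : (lexOrder n).degree t ∈
        (t - coefHi j.val (Finsupp.single j (t.degreeOf j)) t *
          monomial (Finsupp.single j (t.degreeOf j)) 1).support := by
      rwa [← ini_eq_coefHi hj, h0, zero_mul, sub_zero]
    obtain ⟨-, i, hi, hne⟩ := mem_support_sub_coefHi hs0 hmem'
    rcases eq_or_lt_of_le (Fin.le_def.2 hi) with rfl | hlt
    · exact hne (by rw [degree_apply_of_lv hj, Finsupp.single_eq_same])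
    · exact hne (by rw [eq_zero_of_lv_lt hj hmem hlt, Finsupp.single_eq_of_ne hlt.ne'])
  intro hI
  obtain ⟨Q, hQ, -, hle⟩ := hG.1.exists_degree_le hI hini0
  have hm0 := (lexOrder n).degree_mem_support hini0
  set μ := (lexOrder n).degree (ini t)
  have hms : μ + Finsupp.single j (t.degreeOf j) ∈ t.support := by
    rw [mem_support_iff, ← coeff_coefHi hs0 (hlow μ hm0), ← ini_eq_coefHi hj]
    exact mem_support_iff.1 hm0
  by_cases hQt : Q = t
  · have := hle j
    rw [hQt, degree_apply_of_lv hj, hlow μ hm0 j le_rfl] at this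
    exact absurd (degreeOf_pos_of_lv hj) (not_lt.2 this)
  · exact hG.2.2 t htG Q hQ hQt _ hms (hle.trans le_self_add)

theorem exists_isBranching (h : IsWCharSet T I) (hsat : sat T ≠ I) : ∃ Hs, IsBranching I T Hs := by
  obtain ⟨F, hF, hFI⟩ := SetLike.exists_of_lt (lt_of_le_of_ne h.le_sat hsat.symm)
  -- With `F` and the initials themselves as branching polynomials, the two products coincide.
  refine ⟨F :: T.map ini, F, hF, hFI, ?_, fun x => ?_⟩
  · intro H hH
    rcases List.mem_cons.1 hH with rfl | hH
    · exact hFI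
    · obtain ⟨t, ht, rfl⟩ := List.mem_map.1 hH
      cases hj : lv t with
      | bot =>
        have h1 := h.eq_singleton_one ht hj
        have : I = ⊤ := (Ideal.eq_top_iff_one _).2 (h.subset (by rw [h1]; simp))
        exact absurd (this ▸ Submodule.mem_top) hFI
      | coe j => exact h.ini_notMem ht hj
  · rw [List.prod_cons, iniProd]

end PseudoReduction

/-! ### Termination and correctness of the three procedures. -/

section Algorithms

variable {I N : Ideal (MvPolynomial (Fin n) K)} {T : List (MvPolynomial (Fin n) K)}
  {p : PolyPair n K}

theorem exists_srcPair (I : Ideal (MvPolynomial (Fin n) K)) : ∃ p, SrcPair I p := by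
  induction I using WellFoundedGT.induction with
  | ind I ih =>
  obtain ⟨T, hT⟩ := exists_isWCharSet I
  by_cases hsat : sat T = I
  · obtain ⟨G, hG⟩ := exists_isReducedGB I
    exact ⟨_, .done hG hT hsat⟩
  · obtain ⟨p, hp⟩ := ih (sat T) (lt_of_le_of_ne hT.le_sat (Ne.symm hsat))
    exact ⟨p, .saturate hT hsat hp⟩

theorem SrcPair.isSrcPair (h : SrcPair I p) : IsSrcPair p ∧ I ≤ p.ideal := by
  induction h with
  | @done I G T hG hT hsat =>
    have hid : PolyPair.ideal (G, T) = I := hG.span_eq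
    refine ⟨⟨⟨?_, ?_⟩, ?_, hT.isRegularSet hsat⟩, hid.ge⟩
    · rw [hid]; exact hG
    · rw [hid]; exact hT
    · rw [hid]; exact hsat
  | saturate hT _ _ ih => exact ⟨ih.1, hT.le_sat.trans ih.2⟩

theorem SrcPair.ideal_eq (h : SrcPair N p) (hT : IsWCharSet T N) (hsat : sat T = N) :
    p.ideal = N := by
  cases h with
  | done hG _ _ => exact hG.span_eq
  | saturate hT' hne _ => exact absurd (hT.eq hT' ▸ hsat) hne

theorem lt_sup_span_singleton {H : MvPolynomial (Fin n) K} (hH : H ∉ N) :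
    N < N ⊔ Ideal.span {H} := by
  refine lt_of_le_of_ne le_sup_left fun h => hH ?_
  rw [h]
  exact Ideal.mem_sup_right (Ideal.mem_span_singleton_self H)

theorem exists_srcSearch (I N : Ideal (MvPolynomial (Fin n) K)) : ∃ o, SrcSearch I N o := by
  induction N using WellFoundedGT.induction with
  | ind N ih =>
  obtain ⟨p, hp⟩ := exists_srcPair N
  by_cases hd : Divides p.ideal I
  · exact ⟨_, .hit hp hd⟩
  obtain ⟨T, hT⟩ := exists_isWCharSet N
  by_cases hsat : sat T = N
  · exact ⟨_, .leaf hp hd hT hsat⟩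
  obtain ⟨Hs, hHs⟩ := exists_isBranching hT hsat
  -- If no child can return a pair, the induction hypothesis still gives each child an outcome,
  -- which must be failure.
  by_cases hsome : ∃ H ∈ Hs, ∃ q, SrcSearch I (N ⊔ Ideal.span {H}) (some q)
  · obtain ⟨H, hH, q, hq⟩ := hsome
    exact ⟨_, .branchHit hp hd hT hsat hHs hH hq⟩
  · refine ⟨_, .branchFail hp hd hT hsat hHs fun H hH => ?_⟩
    obtain ⟨F, -, -, hN, -⟩ := hHs
    obtain ⟨o, ho⟩ := ih _ (lt_sup_span_singleton (hN H hH))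
    cases o with
    | none => exact ho
    | some q => exact absurd ⟨H, hH, q, ho⟩ hsome

theorem wellFounded_searchCall : WellFounded (SearchCall (K := K) (n := n)) := by
  refine Subrelation.wf (r := fun N' N => N < N') ?_ (wellFounded_gt)
  rintro N' N ⟨T, Hs, -, -, ⟨F, -, -, hN, -⟩, H, hH, rfl⟩
  exact lt_sup_span_singleton (hN H hH)

theorem mem_quot {J : Ideal (MvPolynomial (Fin n) K)} {P : MvPolynomial (Fin n) K} :
    P ∈ quot I J ↔ ∀ Q ∈ J, P * Q ∈ I := Submodule.mem_colon

theorem le_quot (I J : Ideal (MvPolynomial (Fin n) K)) : I ≤ quot I J :=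
  fun _ hP => mem_quot.2 fun _ _ => I.mul_mem_right _ hP

section Nullstellensatz

theorem mem_zeros_iff {S : Set (MvPolynomial (Fin n) K)} {x : Fin n → AlgebraicClosure K} :
    x ∈ zeros S ↔ Ideal.span S ≤ RingHom.ker (aeval x : MvPolynomial (Fin n) K →ₐ[K] _) := by
  rw [Ideal.span_le]; exact Iff.rfl

theorem zeros_span (S : Set (MvPolynomial (Fin n) K)) :
    zeros (Ideal.span S : Set (MvPolynomial (Fin n) K)) = zeros S := by
  ext x
  rw [mem_zeros_iff, mem_zeros_iff, Ideal.span_eq]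

theorem mem_radical_iff_zeros {P : MvPolynomial (Fin n) K} :
    P ∈ I.radical ↔ ∀ x ∈ zeros (I : Set (MvPolynomial (Fin n) K)), aeval x P = 0 := by
  rw [← vanishingIdeal_zeroLocus_eq_radical (K := AlgebraicClosure K)]
  exact Iff.rfl

/-- A point is a zero of an ideal exactly when the kernel of evaluation contains it. This kernel is
prime, so it contains a finite intersection only if it contains one of the members; the converse is
the Nullstellensatz. -/
theorem radical_eq_iInf_iff_zeros_eq_iUnion {ι : Type*} {Ψ : Set ι} (hΨ : Ψ.Finite)
    (I : Ideal (MvPolynomial (Fin n) K)) (J : ι → Ideal (MvPolynomial (Fin n) K)) :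
    I.radical = ⨅ p ∈ Ψ, (J p).radical ↔
      zeros (I : Set (MvPolynomial (Fin n) K)) = ⋃ p ∈ Ψ, zeros (J p : Set _) := by
  constructor
  · intro h
    ext x
    have hp : (RingHom.ker (aeval x : MvPolynomial (Fin n) K →ₐ[K] AlgebraicClosure K)).IsPrime :=
      RingHom.ker_isPrime _
    rw [mem_zeros_iff, Ideal.span_eq, ← hp.radical_le_iff, h]
    have hfin : ⨅ p ∈ Ψ, (J p).radical = hΨ.toFinset.inf fun p => (J p).radical := by
      rw [Finset.inf_eq_iInf]; simp
    rw [hfin, Ideal.IsPrime.inf_le' hp]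
    simp only [hΨ.mem_toFinset, hp.radical_le_iff, Set.mem_iUnion, mem_zeros_iff, Ideal.span_eq,
      exists_prop]
  · intro h
    ext P
    rw [mem_radical_iff_zeros, h]
    simp only [Set.mem_iUnion, Ideal.mem_iInf, mem_radical_iff_zeros]
    exact ⟨fun H p hp x hx => H x ⟨p, hp, hx⟩, fun H x ⟨p, hp, hx⟩ => H p hp x hx⟩

theorem idealDecomposition_iff_zeroDecomposition (F : Finset (MvPolynomial (Fin n) K))
    {Ψ : Set (PolyPair n K)} (hΨ : Ψ.Finite) :
    IdealDecomposition F Ψ ↔ ZeroDecomposition F Ψ := by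
  rw [IdealDecomposition, ZeroDecomposition, and_comm,
    radical_eq_iInf_iff_zeros_eq_iUnion hΨ _ fun p : PolyPair n K => sat p.2,
    radical_eq_iInf_iff_zeros_eq_iUnion hΨ _ fun p : PolyPair n K => p.ideal]
  simp only [PolyPair.ideal, zeros_span]

end Nullstellensatz

/-- If the search fails at `N`, then no associated prime `I : a` of `I` contains `N`. -/
theorem SrcSearch.not_le_of_eq_colon (h : SrcSearch I N none) {a : MvPolynomial (Fin n) K}
    {𝔭 : Ideal (MvPolynomial (Fin n) K)} (hp : 𝔭.IsPrime) (hpa : 𝔭 = Submodule.colon I {a}) :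
    ¬ N ≤ 𝔭 := by
  generalize ho : (none : Option (PolyPair n K)) = o at h
  induction h with
  | hit => exact absurd ho (by simp)
  | branchHit => exact absurd ho (by simp)
  | leaf hsp hd hT hsat =>
    intro hle
    rw [Divides, not_not, hsp.ideal_eq hT hsat] at hd
    -- At a leaf, `N ≤ I : a` means `a ∈ I : N`, and `I : N = I` because `N` does not divide `I`.
    -- Then `I : a` is the unit ideal.
    have ha : a ∈ I := by
      rw [← hd, mem_quot]
      intro Q hQ
      have := hle hQ
      rw [hpa, Submodule.mem_colon_singleton, smul_eq_mul] at this
      rwa [mul_comm]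
    refine hp.ne_top ((Ideal.eq_top_iff_one _).2 ?_)
    rw [hpa, Submodule.mem_colon_singleton, one_smul]
    exact ha
  | @branchFail N p T Hs hsp hd hT hsat hHs hfail ih =>
    intro hle
    obtain ⟨F, hF, -, -, hz⟩ := hHs
    -- An `H` in `𝔭` would give a failing child that is contained in `𝔭`.
    have hH : ∀ H ∈ Hs, H ∉ 𝔭 := fun H hH hHp =>
      ih H hH rfl (sup_le hle ((Ideal.span_singleton_le_iff_mem _).2 hHp))
    have hprod : Hs.prod ∉ 𝔭 := by
      have : Hs.prod ∈ 𝔭.primeCompl := list_prod_mem hH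
      exact this
    have hrad : Hs.prod ∈ (Ideal.span {F * iniProd T}).radical := by
      rw [mem_radical_iff_zeros]
      intro x hx
      exact (hz x).2 (hx _ (Ideal.mem_span_singleton_self _))
    have hFJ : F * iniProd T ∉ 𝔭 := fun hmem =>
      hprod (hp.radical_le_iff.2 ((Ideal.span_singleton_le_iff_mem _).2 hmem) hrad)
    obtain ⟨k, hk⟩ := hF
    have hmem : F * iniProd T ^ k ∈ 𝔭 :=
      hle (Ideal.span_le.2 (fun t ht => hT.subset ht) hk)
    rcases hp.mem_or_mem hmem with h | h
    · exact hFJ (𝔭.mul_mem_right _ h)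
    · exact hFJ (𝔭.mul_mem_left _ (hp.mem_of_pow_mem _ h))

theorem not_srcSearch_none (hI : I ≠ ⊤) : ¬ SrcSearch I I none := by
  intro h
  have : Nontrivial (MvPolynomial (Fin n) K ⧸ I) := Ideal.Quotient.nontrivial_iff.2 hI
  -- A nonzero module over a Noetherian ring has an associated prime; lifting the annihilated
  -- element to `a` gives `𝔭 = I : a`, which contains the root `I`.
  obtain ⟨𝔭, h𝔭⟩ := associatedPrimes.nonempty (MvPolynomial (Fin n) K) (MvPolynomial (Fin n) K ⧸ I)
  obtain ⟨hp, x, hx⟩ := Submodule.isAssociatedPrime_iff.1 h𝔭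
  obtain ⟨a, rfl⟩ := Ideal.Quotient.mk_surjective x
  have hpa : 𝔭 = Submodule.colon I {a} := by
    rw [hx]
    ext r
    rw [Submodule.mem_colon_singleton, Submodule.mem_colon_singleton, Submodule.mem_bot,
      ← Ideal.Quotient.eq_zero_iff_mem]
    rfl
  refine h.not_le_of_eq_colon hp hpa ?_
  rw [hpa]
  exact Ideal.le_colon

theorem SrcSearch.isSrcDivisor {o : Option (PolyPair n K)} (h : SrcSearch I N o) :
    ∀ p, o = some p → IsSrcDivisor p I ∧ N ≤ p.ideal := by
  induction h with
  | hit hsp hd =>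
    rintro p ⟨⟩
    exact ⟨⟨hsp.isSrcPair.1, hd⟩, hsp.isSrcPair.2⟩
  | leaf => rintro p ⟨⟩
  | branchHit _ _ _ _ _ _ _ ih =>
    intro p hp
    exact ⟨(ih p hp).1, le_sup_left.trans (ih p hp).2⟩
  | branchFail => rintro p ⟨⟩

theorem SrcDiv.isSrcDivisor (h : SrcDiv I p) : IsSrcDivisor p I ∧ I ≤ p.ideal :=
  SrcSearch.isSrcDivisor h p rfl

theorem exists_srcDiv (hI : I ≠ ⊤) : ∃ p, SrcDiv I p := by
  obtain ⟨o, ho⟩ := exists_srcSearch I I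
  cases o with
  | none => exact absurd ho (not_srcSearch_none hI)
  | some p => exact ⟨p, ho⟩

theorem Divides.lt_quot {J : Ideal (MvPolynomial (Fin n) K)} (h : Divides J I) : I < quot I J :=
  lt_of_le_of_ne (le_quot I J) (Ne.symm h)

theorem wellFounded_srcDecStep :
    WellFounded (fun s t : Ideal (MvPolynomial (Fin n) K) × Set (PolyPair n K) =>
      SrcDecStep t s) := by
  refine Subrelation.wf (r := InvImage (fun J I => I < J) Prod.fst) ?_
    (InvImage.wf _ wellFounded_gt)
  rintro s t ⟨-, hp⟩
  exact hp.isSrcDivisor.1.2.lt_quot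

theorem exists_srcDecReturns (F : Finset (MvPolynomial (Fin n) K)) : ∃ Ψ, SrcDecReturns F Ψ := by
  have key : ∀ (I : Ideal (MvPolynomial (Fin n) K)) (Ψ : Set (PolyPair n K)),
      ∃ Ψ', Relation.ReflTransGen SrcDecStep (I, Ψ) (⊤, Ψ') := by
    intro I
    induction I using WellFoundedGT.induction with
    | ind I ih =>
    intro Ψ
    by_cases hI : I = ⊤
    · exact ⟨Ψ, by rw [hI]⟩
    · obtain ⟨p, hp⟩ := exists_srcDiv hI
      obtain ⟨Ψ', h⟩ := ih _ hp.isSrcDivisor.1.2.lt_quot (insert p Ψ)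
      exact ⟨Ψ', .head (.mk hI hp) h⟩
  exact key _ _

/-- If `P ^ a ∈ I : J` and `P ^ b ∈ J`, then `P ^ (a + b) ∈ I`. -/
theorem radical_eq_radical_quot_inf {J : Ideal (MvPolynomial (Fin n) K)} (h : I ≤ J) :
    I.radical = (quot I J).radical ⊓ J.radical := by
  refine le_antisymm (le_inf (Ideal.radical_mono (le_quot I J)) (Ideal.radical_mono h)) ?_
  rintro P ⟨⟨a, ha⟩, ⟨b, hb⟩⟩
  exact ⟨a + b, by rw [pow_add]; exact mem_quot.1 ha _ hb⟩

theorem Divides.ne_top {J : Ideal (MvPolynomial (Fin n) K)} (h : Divides J I) : J ≠ ⊤ := by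
  rintro rfl
  refine h (le_antisymm (fun P hP => ?_) (le_quot I ⊤))
  simpa using mem_quot.1 hP 1 Submodule.mem_top

/-- The loop invariant. In a final state the first component is the unit ideal and drops out of the
intersection. The containment of `F` in every pair's ideal yields the statements on `⟨F⟩ = ⟨1⟩` and
on nonempty `C`. -/
theorem srcDecStep_invariant {F : Ideal (MvPolynomial (Fin n) K)}
    {s : Ideal (MvPolynomial (Fin n) K) × Set (PolyPair n K)}
    (h : Relation.ReflTransGen SrcDecStep (F, ∅) s) :
    F ≤ s.1 ∧ s.2.Finite ∧ (∀ p ∈ s.2, IsSrcPair p ∧ p.ideal ≠ ⊤ ∧ F ≤ p.ideal) ∧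
      F.radical = s.1.radical ⊓ ⨅ p ∈ s.2, p.ideal.radical := by
  induction h with
  | refl => simp
  | tail _ hst ih =>
    obtain ⟨hle, hfin, hpairs, hrad⟩ := ih
    cases hst with
    | @mk I Ψ p _ hp =>
    obtain ⟨⟨hsrc, hdiv⟩, hIp⟩ := hp.isSrcDivisor
    refine ⟨hle.trans (le_quot _ _), hfin.insert p, ?_, ?_⟩
    · intro q hq
      rcases Set.mem_insert_iff.1 hq with rfl | hq
      · exact ⟨hsrc, hdiv.ne_top, hle.trans hIp⟩
      · exact hpairs q hq
    · rw [hrad, iInf_insert, ← inf_assoc]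
      exact congrArg (· ⊓ _) (radical_eq_radical_quot_inf hIp)

theorem sat_nil : sat ([] : List (MvPolynomial (Fin n) K)) = ⊥ := by
  ext P
  rw [mem_sat]
  simp [listIdeal, iniProd]

end Algorithms

end SrcDec

theorem mainTheorem3 {K : Type*} [Field K] [CharZero K] (n : ℕ) :
    -- `srcPair` returns an src pair whose ideal contains the input
    (∀ I : Ideal (MvPolynomial (Fin n) K),
      (∃ p, SrcPair I p) ∧ ∀ p, SrcPair I p → IsSrcPair p ∧ I ≤ p.ideal) ∧
    -- the search in `srcDiv` is never stuck and terminates, whatever is chosen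
    (∀ (N : Ideal (MvPolynomial (Fin n) K)) (T : List (MvPolynomial (Fin n) K)),
      IsWCharSet T N → sat T ≠ N → ∃ Hs, IsBranching N T Hs) ∧
    WellFounded (SearchCall (K := K) (n := n)) ∧
    -- on a proper ideal it never fails, and it returns src divisors that contain the ideal
    (∀ I : Ideal (MvPolynomial (Fin n) K), I ≠ ⊤ →
      (∃ p, SrcDiv I p) ∧ ¬ SrcSearch I I none ∧
        ∀ p, SrcDiv I p → IsSrcDivisor p I ∧ I ≤ p.ideal) ∧
    -- `srcDec` is never stuck and terminates, whatever is chosen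
    (∀ (I : Ideal (MvPolynomial (Fin n) K)) (Ψ : Set (PolyPair n K)), I ≠ ⊤ →
      ∃ s, SrcDecStep (I, Ψ) s) ∧
    WellFounded (fun s t : Ideal (MvPolynomial (Fin n) K) × Set (PolyPair n K) =>
      SrcDecStep t s) ∧
    -- correctness of `srcDec`
    (∀ F : Finset (MvPolynomial (Fin n) K),
      (∃ Ψ, SrcDecReturns F Ψ) ∧
      ∀ Ψ, SrcDecReturns F Ψ →
        Ψ.Finite ∧
        (∀ p ∈ Ψ, IsSrcPair p ∧ p.1 ≠ {1}) ∧
        ((∃ P ∈ F, P ≠ 0) → ∀ p ∈ Ψ, p.2 ≠ []) ∧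
        (Ideal.span (F : Set (MvPolynomial (Fin n) K)) = ⊤ → Ψ = ∅) ∧
        IdealDecomposition F Ψ ∧
        ZeroDecomposition F Ψ) ∧
    -- the two kinds of decompositions are equivalent
    (∀ (F : Finset (MvPolynomial (Fin n) K)) (Ψ : Set (PolyPair n K)), Ψ.Finite →
      (IdealDecomposition F Ψ ↔ ZeroDecomposition F Ψ)) := by
  refine ⟨fun I => ⟨exists_srcPair I, fun p hp => hp.isSrcPair⟩,
    fun N T hT hsat => exists_isBranching hT hsat, wellFounded_searchCall,
    fun I hI => ⟨exists_srcDiv hI, not_srcSearch_none hI, fun p hp => hp.isSrcDivisor⟩,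
    fun I Ψ hI => ?_, wellFounded_srcDecStep, fun F => ⟨exists_srcDecReturns F, fun Ψ hΨ => ?_⟩,
    fun F Ψ hΨ => idealDecomposition_iff_zeroDecomposition F hΨ⟩
  · obtain ⟨p, hp⟩ := exists_srcDiv hI
    exact ⟨_, .mk hI hp⟩
  · obtain ⟨-, hfin, hpairs, hrad⟩ := srcDecStep_invariant hΨ
    have hdec : IdealDecomposition F Ψ := by
      have h : (Ideal.span (F : Set (MvPolynomial (Fin n) K))).radical
          = ⨅ p ∈ Ψ, p.ideal.radical := by
        rw [hrad, Ideal.radical_top, top_inf_eq]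
      refine ⟨h.trans (biInf_congr fun p hp => ?_), h⟩
      rw [(hpairs p hp).1.2.1]
    refine ⟨hfin, fun p hp => ⟨(hpairs p hp).1, fun h1 => ?_⟩, ?_, fun htop => ?_, hdec,
      (idealDecomposition_iff_zeroDecomposition F hfin).1 hdec⟩
    · refine (hpairs p hp).2.1 ?_
      rw [PolyPair.ideal, h1, Finset.coe_singleton, Ideal.span_singleton_one]
    · rintro ⟨P, hPF, hP0⟩ p hp hnil
      obtain ⟨⟨-, hsat, -⟩, -, hle⟩ := hpairs p hp
      -- An empty `C` would make the pair's ideal zero, although it contains `F`.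
      rw [← hsat, hnil, sat_nil] at hle
      exact hP0 (hle (Ideal.subset_span hPF))
    · refine Set.eq_empty_of_forall_notMem fun p hp => ?_
      exact (hpairs p hp).2.1 (top_le_iff.1 (htop ▸ (hpairs p hp).2.2))
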